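/- **Setting.** Let $d\ge 1$ and let $\Omega\subset\mathbb{R}^d$ be a bounded open set with Lipschitz boundary. Let $S_0,S_1\subset\Omega$ be disjoint measurable sets of finite perimeter in $\Omega$ such that $\Omega\setminus(S_0\cup S_1)$ is open with Lipschitz boundary, and put $$\mathcal U=\{\varphi\in L^1(\Omega): \varphi=-1\text{ a.e. on }S_0,\ \varphi=1\text{ a.e. on }S_1\}.$$ Let $b_\varepsilon:[-1,1]\to[0,\overline b_\varepsilon]$ ($\varepsilon>0$) and $b_0:[-1,1]\to[0,+\infty]$ be non-increasing, surjective, continuous functions such that $b_0(0)<+\infty$; $b_\varepsilon\to b_0$ pointwise on $[-1,1]$ as $\varepsilon\to0$; $b_\delta\ge b_\varepsilon$ on $[-1,1]$ whenever $0\le\delta\le\varepsilon$ and $\varepsilon>0$; and $\overline b_\varepsilon\to+\infty$, $\overline b_\varepsilon=o(\varepsilon^{-2/3})$ as $\varepsilon\to0$. The convention $+\infty\cdot 0=0$ is used. For measurable $\psi$ with $|\psi|\le1$ a.e. in $\Omega$ and $\varepsilon>0$, let $\lambda_1^{\varepsilon,\psi}$ be the smallest $\lambda\in\mathbb{R}$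 for which there is $0\ne w\in H^1_0(\Omega)$ with $$\int_\Omega\nabla w\cdot\nabla\eta\,dx+\int_\Omega b_\varepsilon(\psi)\,w\,\eta\,dx=\lambda\int_\Omega w\,\eta\,dx\qquad\text{for all }\eta\in H^1_0(\Omega);$$ such $w$ (for $\lambda=\lambda_1^{\varepsilon,\psi}$) are called first eigenfunctions. Let $\varphi\in BV(\Omega,\{\pm1\})\cap\mathcal U$, put $E^\varphi=\{x\in\Omega:\varphi(x)=1\}$, assume that $E^\varphi$ contains an open ball up to a null set, and let $$V^\varphi=\{\eta\in H^1_0(\Omega):\eta=0\text{ a.e. in }\Omega\setminus E^\varphi\}.$$ Let $\lambda_1^{0,\varphi}$ be the smallest eigenvalue of the limit problem: find $0\neq w\in V^\varphi$ and $\lambda\in\mathbb R$ with $$\int_\Omega\nabla w\cdot\nabla\eta\,dx=\lambda\int_\Omega w\,\eta\,dx\qquad\text{for all }\eta\in V^\varphi.\tag{$*$}$$ **Statement.** Let $(\varepsilon_k)_{k\in\mathbb N}$ be a sequence of positive numbers with $\varepsilon_k\to0$, and let $\varphi_k\in L^1(\Omega)$ satisfy $|\varphi_k|\le1$ a.e.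 in $\Omega$, $$\lim_{k\to\infty}\|\varphi_k-\varphi\|_{L^1(\Omega)}=0\qquad\text{and}\qquad \|\varphi_k-\varphi\|_{L^1(E^\varphi\cap\{\varphi_k<0\})}=O(\varepsilon_k).$$ For each $k$ let $w_k$ be a first eigenfunction for $\varepsilon=\varepsilon_k$, $\psi=\varphi_k$, with $\|w_k\|_{L^2(\Omega)}=1$. Then the smallest eigenvalue $\lambda_1^{0,\varphi}$ of $(*)$ exists, and there are a subsequence $(k_j)_{j\in\mathbb N}$ and an eigenfunction $u\in V^\varphi$ of $(*)$ to the eigenvalue $\lambda_1^{0,\varphi}$ such that $$\lim_{j\to\infty}\int_\Omega b_{\varepsilon_{k_j}}(\varphi_{k_j})\,|w_{k_j}|^2\,dx=\int_\Omega b_0(\varphi)\,|u|^2\,dx=0,$$ $$\lim_{j\to\infty}\|w_{k_j}-u\|_{H^1(\Omega)}=0\qquad\text{and}\qquad \lim_{j\to\infty}\lambda_1^{\varepsilon_{k_j},\varphi_{k_j}}=\lambda_1^{0,\varphi}.$$ -/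

import Mathlib

open MeasureTheory Filter Topology Set Asymptotics
open scoped ENNReal RealInnerProductSpace

noncomputable section

namespace PhaseField

/-- Euclidean space of dimension `d`. -/
abbrev Euc (d : ℕ) : Type := EuclideanSpace ℝ (Fin d)

variable {d : ℕ}

/-! ### Geometry: Lipschitz boundary, functions of bounded variation -/

/-- `Ω` has Lipschitz boundary: near each boundary point, for a suitable direction `e`, the set
`Ω` is the region strictly above the graph of a Lipschitz function of the coordinates orthogonal
to `e`. -/
def HasLipschitzBoundary (Ω : Set (Euc d)) : Prop :=
  ∀ x ∈ frontier Ω, ∃ (e : Euc d) (γ : Euc d → ℝ) (K : NNReal) (U : Set (Euc d)),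
    ‖e‖ = 1 ∧ LipschitzWith K γ ∧ IsOpen U ∧ x ∈ U ∧
      ∀ y ∈ U, (y ∈ Ω ↔ γ (y - ⟪e, y⟫ • e) < ⟪e, y⟫)

/-- Divergence of a vector field. -/
def divergence (ξ : Euc d → Euc d) (x : Euc d) : ℝ :=
  ∑ i : Fin d, (fderiv ℝ ξ x (EuclideanSpace.single i 1)) i

/-- `f ∈ BV(Ω)`: `f ∈ L¹(Ω)` and the total variation
`sup {∫_Ω f div ξ : ξ ∈ C¹_c(Ω; ℝᵈ), |ξ| ≤ 1}` is finite. -/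
def MemBV (Ω : Set (Euc d)) (f : Euc d → ℝ) : Prop :=
  IntegrableOn f Ω ∧
    ∃ C : ℝ, ∀ ξ : Euc d → Euc d, ContDiff ℝ 1 ξ → HasCompactSupport ξ → tsupport ξ ⊆ Ω →
      (∀ x, ‖ξ x‖ ≤ 1) → ∫ x in Ω, f x * divergence ξ x ≤ C

/-- `f ∈ BV(Ω, {±1})`. -/
def MemBVSign (Ω : Set (Euc d)) (f : Euc d → ℝ) : Prop :=
  MemBV Ω f ∧ ∀ᵐ x ∂(volume.restrict Ω), f x = 1 ∨ f x = -1

/-- The set `𝓤` of `L¹(Ω)` phase fields equal to `-1` on `S₀` and to `1` on `S₁`. -/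
def MemU (Ω S₀ S₁ : Set (Euc d)) (f : Euc d → ℝ) : Prop :=
  IntegrableOn f Ω ∧ (∀ᵐ x ∂(volume.restrict S₀), f x = -1) ∧
    (∀ᵐ x ∂(volume.restrict S₁), f x = 1)

/-- Standing assumptions on the design domain `Ω` and on the sets `S₀`, `S₁` where the
phase field is prescribed. -/
structure IsDesign (Ω S₀ S₁ : Set (Euc d)) : Prop where
  isOpen : IsOpen Ω
  isBounded : Bornology.IsBounded Ω
  lipschitz : HasLipschitzBoundary Ω
  measurable₀ : MeasurableSet S₀
  measurable₁ : MeasurableSet S₁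
  subset₀ : S₀ ⊆ Ω
  subset₁ : S₁ ⊆ Ω
  disjoint : Disjoint S₀ S₁
  isOpen_diff : IsOpen (Ω \ (S₀ ∪ S₁))
  lipschitz_diff : HasLipschitzBoundary (Ω \ (S₀ ∪ S₁))
  perimeter₀ : MemBV Ω (S₀.indicator fun _ => (1 : ℝ))
  perimeter₁ : MemBV Ω (S₁.indicator fun _ => (1 : ℝ))

/-! ### The coefficient functions -/

/-- Assumptions on the coefficients `b_ε : [-1,1] → [0, bbar_ε]` (`ε > 0`) and
`b₀ : [-1,1] → [0,∞]`. The functions are only used on `[-1,1]`. -/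
structure IsCoefficientFamily (b : ℝ → ℝ → ℝ) (b₀ : ℝ → ℝ≥0∞) (bbar : ℝ → ℝ) : Prop where
  antitone : ∀ ε > 0, AntitoneOn (b ε) (Icc (-1) 1)
  continuous : ∀ ε > 0, ContinuousOn (b ε) (Icc (-1) 1)
  image : ∀ ε > 0, b ε '' Icc (-1) 1 = Icc 0 (bbar ε)
  antitone_zero : AntitoneOn b₀ (Icc (-1) 1)
  continuous_zero : ContinuousOn b₀ (Icc (-1) 1)
  image_zero : b₀ '' Icc (-1) 1 = univ
  finite_zero : b₀ 0 < ⊤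
  tendsto : ∀ t ∈ Icc (-1 : ℝ) 1,
    Tendsto (fun ε => ENNReal.ofReal (b ε t)) (𝓝[>] 0) (𝓝 (b₀ t))
  mono : ∀ δ ε : ℝ, 0 < δ → δ ≤ ε → ∀ t ∈ Icc (-1 : ℝ) 1, b ε t ≤ b δ t
  le_zero : ∀ ε > 0, ∀ t ∈ Icc (-1 : ℝ) 1, ENNReal.ofReal (b ε t) ≤ b₀ t
  bbar_tendsto : Tendsto bbar (𝓝[>] 0) atTop
  bbar_isLittleO : bbar =o[𝓝[>] 0] fun ε : ℝ => ε ^ (-(2 / 3) : ℝ)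

/-! ### Sobolev spaces -/

/-- `L²(Ω; F)`. -/
abbrev L2 (Ω : Set (Euc d)) (F : Type) [NormedAddCommGroup F] : Type :=
  Lp F 2 ((volume : Measure (Euc d)).restrict Ω)

/-- Test functions on `Ω`: smooth with compact support contained in `Ω`. -/
def IsTest (Ω : Set (Euc d)) (ψ : Euc d → ℝ) : Prop :=
  ContDiff ℝ (⊤ : ℕ∞) ψ ∧ HasCompactSupport ψ ∧ tsupport ψ ⊆ Ω

/-- `g` is the weak gradient of `u` on `Ω`. -/
def IsWeakGradient (Ω : Set (Euc d)) (u : L2 Ω ℝ) (g : L2 Ω (Euc d)) : Prop :=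
  ∀ ψ : Euc d → ℝ, IsTest Ω ψ → ∀ v : Euc d,
    ∫ x in Ω, u x * fderiv ℝ ψ x v = -∫ x in Ω, ⟪g x, v⟫ * ψ x

theorem IsTest.memLp {Ω : Set (Euc d)} {ψ : Euc d → ℝ} (h : IsTest Ω ψ) :
    MemLp ψ 2 (volume.restrict Ω) :=
  (h.1.continuous.memLp_of_hasCompactSupport h.2.1 (p := 2) (μ := volume)).restrict Ω

theorem IsTest.memLp_fderiv {Ω : Set (Euc d)} {ψ : Euc d → ℝ} (h : IsTest Ω ψ) (v : Euc d) :
    MemLp (fun x => fderiv ℝ ψ x v) 2 (volume.restrict Ω) := by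
  have hc : Continuous fun x => fderiv ℝ ψ x v :=
    (h.1.continuous_fderiv (by simp)).clm_apply continuous_const
  have hs : HasCompactSupport fun x => fderiv ℝ ψ x v := h.2.1.fderiv_apply ℝ v
  exact (hc.memLp_of_hasCompactSupport hs (p := 2) (μ := volume)).restrict Ω

theorem integrable_left {Ω : Set (Euc d)} {ψ : Euc d → ℝ} (h : IsTest Ω ψ) (v : Euc d)
    (u : L2 Ω ℝ) : Integrable (fun x => u x * fderiv ℝ ψ x v) (volume.restrict Ω) :=
  (Lp.memLp u).integrable_mul (h.memLp_fderiv v)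

theorem integrable_right {Ω : Set (Euc d)} {ψ : Euc d → ℝ} (h : IsTest Ω ψ) (v : Euc d)
    (g : L2 Ω (Euc d)) : Integrable (fun x => ⟪g x, v⟫ * ψ x) (volume.restrict Ω) :=
  ((Lp.memLp g).inner_const v).integrable_mul h.memLp

/-- The subspace of all pairs `(u, ∇u)` in `L²(Ω) × L²(Ω; ℝᵈ)`, where `∇u` is the weak gradient
of `u`. -/
def sobolevPairs (Ω : Set (Euc d)) : Submodule ℝ (WithLp 2 (L2 Ω ℝ × L2 Ω (Euc d))) where
  carrier := {p | IsWeakGradient Ω p.fst p.snd}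
  zero_mem' := by
    intro ψ h v
    have h1 : (fun x => (0 : L2 Ω ℝ) x * fderiv ℝ ψ x v) =ᵐ[volume.restrict Ω] 0 := by
      filter_upwards [Lp.coeFn_zero ℝ 2 (volume.restrict Ω)] with x hx
      rw [hx]; simp
    have h2 : (fun x => ⟪(0 : L2 Ω (Euc d)) x, v⟫ * ψ x) =ᵐ[volume.restrict Ω] 0 := by
      filter_upwards [Lp.coeFn_zero (Euc d) 2 (volume.restrict Ω)] with x hx
      rw [hx]; simp
    rw [WithLp.zero_fst, WithLp.zero_snd, integral_congr_ae h1, integral_congr_ae h2]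
    simp
  add_mem' := by
    intro p q hp hq ψ h v
    have h1 : (fun x => (p.fst + q.fst : L2 Ω ℝ) x * fderiv ℝ ψ x v) =ᵐ[volume.restrict Ω]
        fun x => p.fst x * fderiv ℝ ψ x v + q.fst x * fderiv ℝ ψ x v := by
      filter_upwards [Lp.coeFn_add p.fst q.fst] with x hx
      rw [hx, Pi.add_apply, add_mul]
    have h2 : (fun x => ⟪(p.snd + q.snd : L2 Ω (Euc d)) x, v⟫ * ψ x) =ᵐ[volume.restrict Ω]
        fun x => ⟪p.snd x, v⟫ * ψ x + ⟪q.snd x, v⟫ * ψ x := by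
      filter_upwards [Lp.coeFn_add p.snd q.snd] with x hx
      rw [hx, Pi.add_apply, inner_add_left, add_mul]
    rw [WithLp.add_fst, WithLp.add_snd, integral_congr_ae h1, integral_congr_ae h2,
      integral_add (integrable_left h v _) (integrable_left h v _),
      integral_add (integrable_right h v _) (integrable_right h v _), hp ψ h v, hq ψ h v]
    ring
  smul_mem' := by
    intro c p hp ψ h v
    have h1 : (fun x => (c • p.fst : L2 Ω ℝ) x * fderiv ℝ ψ x v) =ᵐ[volume.restrict Ω]
        fun x => c * (p.fst x * fderiv ℝ ψ x v) := by
      filter_upwards [Lp.coeFn_smul c p.fst] with x hx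
      simp [hx, mul_assoc]
    have h2 : (fun x => ⟪(c • p.snd : L2 Ω (Euc d)) x, v⟫ * ψ x) =ᵐ[volume.restrict Ω]
        fun x => c * (⟪p.snd x, v⟫ * ψ x) := by
      filter_upwards [Lp.coeFn_smul c p.snd] with x hx
      simp [hx, inner_smul_left, mul_assoc]
    rw [WithLp.smul_fst, WithLp.smul_snd, integral_congr_ae h1, integral_congr_ae h2,
      integral_const_mul, integral_const_mul, hp ψ h v]
    ring

/-- The Sobolev space `H¹(Ω)`, realised as the space of pairs `(u, ∇u)`; its norm is
`‖u‖² = ‖u‖²_{L²} + ‖∇u‖²_{L²}`. -/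
abbrev H1 (Ω : Set (Euc d)) : Type := ↥(sobolevPairs Ω)

/-- The `L²` function underlying an element of `H¹(Ω)`. -/
def H1.fn {Ω : Set (Euc d)} (u : H1 Ω) : L2 Ω ℝ := u.1.fst

/-- The weak gradient of an element of `H¹(Ω)`. -/
def H1.grad {Ω : Set (Euc d)} (u : H1 Ω) : L2 Ω (Euc d) := u.1.snd

theorem H1.norm_sq {Ω : Set (Euc d)} (u : H1 Ω) : ‖u‖ ^ 2 = ‖u.fn‖ ^ 2 + ‖u.grad‖ ^ 2 :=
  WithLp.prod_norm_sq_eq_of_L2 u.1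

/-- `H¹₀(Ω)`: the closure in `H¹(Ω)` of the test functions. -/
def H10 (Ω : Set (Euc d)) : Set (H1 Ω) :=
  closure {p : H1 Ω | ∃ ψ : Euc d → ℝ, IsTest Ω ψ ∧ p.fn =ᵐ[volume.restrict Ω] ψ}

/-- The set `E^φ = {x ∈ Ω : φ(x) = 1}`. -/
def posSet (Ω : Set (Euc d)) (φ : Euc d → ℝ) : Set (Euc d) := {x ∈ Ω | φ x = 1}

/-- The space `V^φ` of all `η ∈ H¹₀(Ω)` with `η = 0` a.e. in `Ω \ E^φ`. -/
def V (Ω : Set (Euc d)) (φ : Euc d → ℝ) : Set (H1 Ω) :=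
  {η : H1 Ω | η ∈ H10 Ω ∧ ∀ᵐ x ∂(volume.restrict Ω), x ∉ posSet Ω φ → η.fn x = 0}

/-! ### The eigenvalue problems -/

/-- `w` is an eigenfunction to the eigenvalue `lam` of `-Δw + β(φ) w = lam w` in `Ω`, `w = 0` on
`∂Ω`, in the weak sense. -/
def IsEigenfunction (Ω : Set (Euc d)) (β : ℝ → ℝ) (φ : Euc d → ℝ) (lam : ℝ) (w : H1 Ω) : Prop :=
  w ∈ H10 Ω ∧ w ≠ 0 ∧ ∀ η : H1 Ω, η ∈ H10 Ω →
    (∫ x in Ω, ⟪w.grad x, η.grad x⟫) + ∫ x in Ω, β (φ x) * (w.fn x * η.fn x) =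
      lam * ∫ x in Ω, w.fn x * η.fn x

/-- The first (smallest) eigenvalue of `-Δw + β(φ) w = lam w` in `Ω`, `w = 0` on `∂Ω`. -/
def firstEigenvalue (Ω : Set (Euc d)) (β : ℝ → ℝ) (φ : Euc d → ℝ) : ℝ :=
  sInf {lam | ∃ w : H1 Ω, IsEigenfunction Ω β φ lam w}

/-- `w` is an eigenfunction of the limit problem to the eigenvalue `lam`: `0 ≠ w ∈ V^φ` and
`∫_Ω ∇w·∇η = lam ∫_Ω w η` for all `η ∈ V^φ`. -/
def IsLimitEigenfunction (Ω : Set (Euc d)) (φ : Euc d → ℝ) (lam : ℝ) (w : H1 Ω) : Prop :=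
  w ∈ V Ω φ ∧ w ≠ 0 ∧ ∀ η : H1 Ω, η ∈ V Ω φ →
    ∫ x in Ω, ⟪w.grad x, η.grad x⟫ = lam * ∫ x in Ω, w.fn x * η.fn x

/-- The first (smallest) eigenvalue of the limit problem. -/
def limitFirstEigenvalue (Ω : Set (Euc d)) (φ : Euc d → ℝ) : ℝ :=
  sInf {lam | ∃ w : H1 Ω, IsLimitEigenfunction Ω φ lam w}

end PhaseField

end

open MeasureTheory Filter Topology Set Asymptotics
open scoped ENNReal RealInnerProductSpace

noncomputable section

namespace PhaseField

/-! ### Hilbert space structure of H¹(Ω), and test functions inside it. -/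

section Basics

variable {d : ℕ} {Ω : Set (Euc d)}

/-! Everything is read off the Rayleigh quotient. The first eigenvalue λ_k is at most (‖∇η‖² + ∫
b_{ε_k}(φ_k) η²) / ‖η‖² for every nonzero η ∈ H¹₀(Ω) (`firstEigenvalue_mul_norm_sq_le`), and it
equals ‖∇w_k‖² + ∫ b_{ε_k}(φ_k) w_k² for the normalised w_k.

Upper bound. For bounded η ∈ V^φ the coefficient term tends to 0 (`tendsto_integral_coeff_mul_sq`).
Where φ_k ≥ 0 the coefficient is at most b₀(0) < ∞ and, on E^φ, tends to b₀(1) = 0, so dominated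
convergence applies. Where φ_k < 0 on E^φ one has |φ_k - φ| ≥ 1, so this part is at most a constant
times o(ε_k^{-2/3}) · O(ε_k). Truncation (`exists_bounded_tendsto`) removes the boundedness of η. A
bump function in the given ball keeps λ_k bounded, so along a subsequence λ_k → λ with λ ‖η‖² ≤
‖∇η‖² on V^φ.

Lower bound. The w_k are bounded in H¹₀(Ω), and by Rellich's theorem (`tendsto_fn_of_tendsto_inner`)
a subsequence converges to some u weakly in H¹ and strongly in L². The bounded coefficient terms,
together with the monotonicity of b_ε in ε and the blow-up of its maximum, force u = 0 where φ = -1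
(`mem_V_of_tendsto`).

Conclusion (`tendsto_of_weak_tendsto`). Expanding the square shows ‖w_k - u‖² + ∫ b_{ε_k}(φ_k) w_k²
→ λ - ‖∇u‖². The left side is nonnegative, and λ ≤ ‖∇u‖² because u itself is a competitor. Hence
both summands tend to 0 and u minimises the limit quotient, which gives all the claims at once. -/

theorem L2.inner_eq_integral_mul (f g : L2 Ω ℝ) : ⟪f, g⟫ = ∫ x in Ω, f x * g x := by
  rw [MeasureTheory.L2.inner_def]
  exact integral_congr_ae (ae_of_all _ fun x => by simp [mul_comm])

theorem L2.inner_eq_integral_inner (f g : L2 Ω (Euc d)) : ⟪f, g⟫ = ∫ x in Ω, ⟪f x, g x⟫ :=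
  MeasureTheory.L2.inner_def f g

theorem L2.norm_sq_eq_integral (f : L2 Ω ℝ) : ‖f‖ ^ 2 = ∫ x in Ω, f x ^ 2 := by
  rw [← real_inner_self_eq_norm_sq, L2.inner_eq_integral_mul]
  simp_rw [sq]

theorem L2.integrable_mul (f g : L2 Ω ℝ) :
    Integrable (fun x => f x * g x) (volume.restrict Ω) :=
  (Lp.memLp f).integrable_mul (Lp.memLp g)

theorem L2.integrable_sq (f : L2 Ω ℝ) : Integrable (fun x => f x ^ 2) (volume.restrict Ω) :=
  (Lp.memLp f).integrable_sq

theorem H1.inner_eq (u v : H1 Ω) : ⟪u, v⟫ = ⟪u.fn, v.fn⟫ + ⟪u.grad, v.grad⟫ := by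
  rw [Submodule.coe_inner, WithLp.prod_inner_apply]
  rfl

@[simp] theorem H1.fn_add (u v : H1 Ω) : (u + v).fn = u.fn + v.fn := rfl
@[simp] theorem H1.fn_sub (u v : H1 Ω) : (u - v).fn = u.fn - v.fn := rfl
@[simp] theorem H1.fn_smul (c : ℝ) (u : H1 Ω) : (c • u).fn = c • u.fn := rfl
@[simp] theorem H1.grad_add (u v : H1 Ω) : (u + v).grad = u.grad + v.grad := rfl
@[simp] theorem H1.grad_sub (u v : H1 Ω) : (u - v).grad = u.grad - v.grad := rfl
@[simp] theorem H1.grad_smul (c : ℝ) (u : H1 Ω) : (c • u).grad = c • u.grad := rfl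

theorem H1.norm_fn_le (u : H1 Ω) : ‖u.fn‖ ≤ ‖u‖ :=
  le_of_sq_le_sq (by rw [H1.norm_sq]; nlinarith [sq_nonneg ‖u.grad‖]) (norm_nonneg _)

theorem H1.continuous_fn : Continuous (H1.fn : H1 Ω → L2 Ω ℝ) :=
  (WithLp.prod_continuous_ofLp 2 _ _).fst.comp continuous_subtype_val

theorem H1.continuous_grad : Continuous (H1.grad : H1 Ω → L2 Ω (Euc d)) :=
  (WithLp.prod_continuous_ofLp 2 _ _).snd.comp continuous_subtype_val

/-- Convergence in `H¹` is convergence of the function and of its gradient in `L²`. -/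
theorem H1.tendsto_of_fn_of_grad {ι : Type*} {l : Filter ι} {u : ι → H1 Ω} {v : H1 Ω}
    (hf : Tendsto (fun i => (u i).fn) l (𝓝 v.fn))
    (hg : Tendsto (fun i => (u i).grad) l (𝓝 v.grad)) : Tendsto u l (𝓝 v) := by
  rw [tendsto_iff_norm_sub_tendsto_zero] at hf hg ⊢
  have h : Tendsto (fun i => ‖u i - v‖ ^ 2) l (𝓝 0) := by
    have := (hf.pow 2).add (hg.pow 2)
    simp only [ne_eq, OfNat.ofNat_ne_zero, not_false_eq_true, zero_pow, add_zero] at this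
    refine this.congr fun i => ?_
    rw [H1.norm_sq]; rfl
  have := h.sqrt
  simpa using this

/-- Each defining identity equates two inner products with fixed L² elements built from the test
function, hence is a closed condition on the pair. This makes H¹(Ω) a Hilbert space. -/
theorem isClosed_sobolevPairs :
    IsClosed (sobolevPairs Ω : Set (WithLp 2 (L2 Ω ℝ × L2 Ω (Euc d)))) := by
  have : (sobolevPairs Ω : Set (WithLp 2 (L2 Ω ℝ × L2 Ω (Euc d)))) =
      ⋂ (ψ : Euc d → ℝ) (_ : IsTest Ω ψ) (v : Euc d),
        {p | ∫ x in Ω, p.fst x * fderiv ℝ ψ x v = -∫ x in Ω, ⟪p.snd x, v⟫ * ψ x} := by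
    ext p
    simp only [mem_iInter]
    rfl
  rw [this]
  refine isClosed_iInter fun ψ => isClosed_iInter fun h => isClosed_iInter fun v => ?_
  have hv : MemLp (fun x => ψ x • v) 2 (volume.restrict Ω) := by
    exact (memLp_top_const v : MemLp (fun _ : Euc d => v) ⊤ (volume.restrict Ω)).smul h.memLp
  have h1 : ∀ p : WithLp 2 (L2 Ω ℝ × L2 Ω (Euc d)), ∫ x in Ω, p.fst x * fderiv ℝ ψ x v =
      ⟪p.fst, (h.memLp_fderiv v).toLp⟫ := fun p => by
    rw [L2.inner_eq_integral_mul]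
    refine integral_congr_ae ?_
    filter_upwards [(h.memLp_fderiv v).coeFn_toLp] with x hx
    rw [hx]
  have h2 : ∀ p : WithLp 2 (L2 Ω ℝ × L2 Ω (Euc d)), ∫ x in Ω, ⟪p.snd x, v⟫ * ψ x =
      ⟪p.snd, hv.toLp⟫ := fun p => by
    rw [L2.inner_eq_integral_inner]
    refine integral_congr_ae ?_
    filter_upwards [hv.coeFn_toLp] with x hx
    rw [hx, inner_smul_right, mul_comm]
  simp_rw [h1, h2]
  have c1 : Continuous fun p : WithLp 2 (L2 Ω ℝ × L2 Ω (Euc d)) => p.fst :=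
    (WithLp.prod_continuous_ofLp 2 _ _).fst
  have c2 : Continuous fun p : WithLp 2 (L2 Ω ℝ × L2 Ω (Euc d)) => p.snd :=
    (WithLp.prod_continuous_ofLp 2 _ _).snd
  exact isClosed_eq (c1.inner continuous_const) (c2.inner continuous_const).neg

instance : CompleteSpace (H1 Ω) := isClosed_sobolevPairs.completeSpace_coe

theorem IsTest.memLp_gradient {ψ : Euc d → ℝ} (h : IsTest Ω ψ) :
    MemLp (gradient ψ) 2 (volume.restrict Ω) := by
  have hc : Continuous (gradient ψ) :=
    (InnerProductSpace.toDual ℝ (Euc d)).symm.continuous.comp (h.1.continuous_fderiv (by simp))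
  have hs : HasCompactSupport (gradient ψ) :=
    (h.2.1.fderiv ℝ).comp_left (g := (InnerProductSpace.toDual ℝ (Euc d)).symm) (map_zero _)
  exact (hc.memLp_of_hasCompactSupport hs (p := 2) (μ := volume)).restrict Ω

theorem inner_gradient_left (ψ : Euc d → ℝ) (x v : Euc d) :
    ⟪gradient ψ x, v⟫ = fderiv ℝ ψ x v := by
  simp [gradient]

theorem IsTest.eq_zero_of_notMem {ψ : Euc d → ℝ} (h : IsTest Ω ψ) {x : Euc d} (hx : x ∉ Ω) :
    ψ x = 0 :=
  image_eq_zero_of_notMem_tsupport fun hx' => hx (h.2.2 hx')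

theorem IsTest.gradient_eq_zero_of_notMem {ψ : Euc d → ℝ} (h : IsTest Ω ψ) {x : Euc d}
    (hx : x ∉ Ω) : gradient ψ x = 0 := by
  have : fderiv ℝ ψ x = 0 :=
    image_eq_zero_of_notMem_tsupport fun hx' => hx (h.2.2 (tsupport_fderiv_subset ℝ hx'))
  simp [gradient, this]

/-- Both integrands vanish outside Ω, so the integration by parts takes place on the whole space and
needs no regularity of Ω. -/
theorem IsTest.isWeakGradient {ψ : Euc d → ℝ} (h : IsTest Ω ψ) :
    IsWeakGradient Ω h.memLp.toLp h.memLp_gradient.toLp := by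
  intro θ hθ v
  have h1 : (fun x => (h.memLp.toLp ψ : L2 Ω ℝ) x * fderiv ℝ θ x v) =ᵐ[volume.restrict Ω]
      fun x => ψ x * fderiv ℝ θ x v := by
    filter_upwards [h.memLp.coeFn_toLp] with x hx
    rw [hx]
  have h2 : (fun x => ⟪(h.memLp_gradient.toLp (gradient ψ) : L2 Ω (Euc d)) x, v⟫ * θ x)
      =ᵐ[volume.restrict Ω] fun x => fderiv ℝ ψ x v * θ x := by
    filter_upwards [h.memLp_gradient.coeFn_toLp] with x hx
    rw [hx, inner_gradient_left]
  rw [integral_congr_ae h1, integral_congr_ae h2,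
    setIntegral_eq_integral_of_forall_compl_eq_zero fun x hx => by
      rw [h.eq_zero_of_notMem hx, zero_mul],
    setIntegral_eq_integral_of_forall_compl_eq_zero fun x hx => by
      rw [hθ.eq_zero_of_notMem hx, mul_zero]]
  have cψ := h.1.continuous
  have cθ := hθ.1.continuous
  have cψ' : Continuous fun x => fderiv ℝ ψ x v :=
    (h.1.continuous_fderiv (by simp)).clm_apply continuous_const
  have cθ' : Continuous fun x => fderiv ℝ θ x v :=
    (hθ.1.continuous_fderiv (by simp)).clm_apply continuous_const
  refine integral_mul_fderiv_eq_neg_fderiv_mul_of_integrable ?_ ?_ ?_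
    (fun x _ => (h.1.differentiable (by simp)) x) (fun x _ => (hθ.1.differentiable (by simp)) x)
  · exact (cψ'.mul cθ).integrable_of_hasCompactSupport hθ.2.1.mul_left
  · exact (cψ.mul cθ').integrable_of_hasCompactSupport h.2.1.mul_right
  · exact (cψ.mul cθ).integrable_of_hasCompactSupport h.2.1.mul_right

/-- A test function as an element of `H¹(Ω)`. -/
def IsTest.toH1 {ψ : Euc d → ℝ} (h : IsTest Ω ψ) : H1 Ω :=
  ⟨WithLp.toLp 2 (h.memLp.toLp, h.memLp_gradient.toLp), h.isWeakGradient⟩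

theorem IsTest.toH1_fn {ψ : Euc d → ℝ} (h : IsTest Ω ψ) :
    h.toH1.fn =ᵐ[volume.restrict Ω] ψ := h.memLp.coeFn_toLp

theorem IsTest.toH1_grad {ψ : Euc d → ℝ} (h : IsTest Ω ψ) :
    h.toH1.grad =ᵐ[volume.restrict Ω] gradient ψ := h.memLp_gradient.coeFn_toLp

/-- The weak gradient is determined by the function. -/
theorem H1.ext_fn (hΩ : IsOpen Ω) {u v : H1 Ω} (h : u.fn = v.fn) : u = v := by
  have key : ∀ p : H1 Ω, p.fn = 0 → p.grad = 0 := by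
    intro p hp
    have hcoord : ∀ i : Fin d, ∀ᵐ x, x ∈ Ω → (p.grad x) i = 0 := by
      intro i
      -- Fundamental lemma of the calculus of variations, one coordinate of the gradient at a time.
      refine hΩ.ae_eq_zero_of_integral_contDiff_smul_eq_zero ?_ ?_
      · have hm : MemLp (fun x => (p.grad x) i) 2 (volume.restrict Ω) := by
          have := (Lp.memLp p.grad).inner_const (𝕜 := ℝ) (EuclideanSpace.single i (1 : ℝ))
          simpa [EuclideanSpace.inner_single_right] using this
        exact locallyIntegrableOn_of_locallyIntegrable_restrict (hm.locallyIntegrable (by simp))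
      · intro g hg hgc hgs
        have := p.2 g ⟨hg, hgc, hgs⟩ (EuclideanSpace.single i 1)
        have h0 : ∫ x in Ω, p.fn x * fderiv ℝ g x (EuclideanSpace.single i 1) = 0 := by
          rw [hp]
          refine integral_eq_zero_of_ae ?_
          filter_upwards [Lp.coeFn_zero ℝ 2 (volume.restrict Ω)] with x hx
          rw [hx]; simp
        change ∫ x in Ω, p.fn x * _ = -∫ x in Ω, ⟪p.grad x, _⟫ * _ at this
        rw [h0, eq_comm, neg_eq_zero,
          setIntegral_eq_integral_of_forall_compl_eq_zero fun x hx => by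
            rw [IsTest.eq_zero_of_notMem ⟨hg, hgc, hgs⟩ hx, mul_zero]] at this
        rw [← this]
        exact integral_congr_ae (ae_of_all _ fun x => by
          simp [mul_comm, EuclideanSpace.inner_single_right])
    rw [Lp.eq_zero_iff_ae_eq_zero]
    have hall := (ae_restrict_iff' hΩ.measurableSet).2 (ae_all_iff.2 hcoord |>.mono
      fun x hx hxΩ i => hx i hxΩ : ∀ᵐ x, x ∈ Ω → ∀ i, (p.grad x) i = 0)
    filter_upwards [hall] with x hx
    ext i
    exact hx i
  have h0 : (u - v).grad = 0 := key _ (by simp [h])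
  rw [H1.grad_sub, sub_eq_zero] at h0
  apply Subtype.ext
  apply (WithLp.equiv 2 _).injective
  exact Prod.ext h h0

/-- The submodule of test functions in `H¹(Ω)`. -/
def testSubmodule (Ω : Set (Euc d)) : Submodule ℝ (H1 Ω) where
  carrier := {p : H1 Ω | ∃ ψ : Euc d → ℝ, IsTest Ω ψ ∧ p.fn =ᵐ[volume.restrict Ω] ψ}
  zero_mem' := ⟨0, ⟨contDiff_const, HasCompactSupport.zero, by simp⟩, Lp.coeFn_zero _ _ _⟩
  add_mem' := by
    rintro p q ⟨ψ, hψ, hp⟩ ⟨θ, hθ, hq⟩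
    refine ⟨ψ + θ, ⟨hψ.1.add hθ.1, hψ.2.1.add hθ.2.1, ?_⟩, ?_⟩
    · exact (tsupport_add _ _).trans (union_subset hψ.2.2 hθ.2.2)
    · exact (Lp.coeFn_add p.fn q.fn).trans (hp.add hq)
  smul_mem' := by
    rintro c p ⟨ψ, hψ, hp⟩
    refine ⟨fun x => c * ψ x, ⟨contDiff_const.mul hψ.1, hψ.2.1.mul_left, ?_⟩, ?_⟩
    · exact (tsupport_mul_subset_right).trans hψ.2.2
    · filter_upwards [Lp.coeFn_smul c p.fn, hp] with x h1 h2
      rw [H1.fn_smul, h1, Pi.smul_apply, h2, smul_eq_mul]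

/-- `H¹₀(Ω)` as a closed subspace. -/
def H10Submodule (Ω : Set (Euc d)) : Submodule ℝ (H1 Ω) := (testSubmodule Ω).topologicalClosure

theorem IsTest.toH1_mem {ψ : Euc d → ℝ} (h : IsTest Ω ψ) : h.toH1 ∈ H10 Ω :=
  subset_closure ⟨ψ, h, h.toH1_fn⟩

/-- Elements of `H¹₀` are limits of test functions. -/
theorem exists_isTest_norm_sub_lt (hΩ : IsOpen Ω) {u : H1 Ω} (hu : u ∈ H10 Ω) {r : ℝ}
    (hr : 0 < r) : ∃ (ψ : Euc d → ℝ) (h : IsTest Ω ψ), ‖u - h.toH1‖ < r := by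
  obtain ⟨p, ⟨ψ, h, hp⟩, hpu⟩ := Metric.mem_closure_iff.1 hu r hr
  refine ⟨ψ, h, ?_⟩
  have : h.toH1 = p := H1.ext_fn hΩ (Lp.ext (h.toH1_fn.trans hp.symm))
  rwa [this, ← dist_eq_norm]

end Basics

/-! ### Weak sequential compactness in Hilbert spaces. -/

section WeakCompactness

variable {H : Type*} [NormedAddCommGroup H] [InnerProductSpace ℝ H] [CompleteSpace H]

/-- A strongly closed subspace is weakly sequentially closed. -/
theorem _root_.Submodule.mem_of_tendsto_inner (K : Submodule ℝ H)
    (hK : IsClosed (K : Set H)) {x : ℕ → H} {u : H}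
    (hx : ∀ n, x n ∈ K) (hu : ∀ v, Tendsto (fun n => ⟪x n, v⟫) atTop (𝓝 ⟪u, v⟫)) : u ∈ K := by
  have : CompleteSpace K := hK.completeSpace_coe
  -- A closed subspace is its own double orthogonal complement, so membership is a family of linear
  -- equations, which survive weak limits.
  rw [← K.orthogonal_orthogonal, Submodule.mem_orthogonal']
  intro v hv
  refine tendsto_nhds_unique (hu v) ?_
  simp_rw [fun n => hv _ (hx n)]
  exact tendsto_const_nhds

/-- Bounded sequences in a separable Hilbert space have weakly convergent subsequences. -/
theorem exists_subseq_tendsto_inner [SecondCountableTopology H] {x : ℕ → H} {C : ℝ}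
    (hx : ∀ n, ‖x n‖ ≤ C) : ∃ (u : H) (s : ℕ → ℕ), StrictMono s ∧
      ∀ v, Tendsto (fun n => ⟪x (s n), v⟫) atTop (𝓝 ⟪u, v⟫) := by
  -- The Riesz isometry carries the sequence to the dual, where sequential Banach–Alaoglu applies.
  let y : ℕ → WeakDual ℝ H := fun n => StrongDual.toWeakDual (InnerProductSpace.toDual ℝ H (x n))
  have hy : ∀ n, y n ∈ WeakDual.toStrongDual ⁻¹' Metric.closedBall (0 : StrongDual ℝ H) C := by
    intro n
    simpa [y] using hx n
  obtain ⟨l, -, s, hs, hl⟩ := WeakDual.isSeqCompact_closedBall ℝ H 0 C hy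
  refine ⟨(InnerProductSpace.toDual ℝ H).symm (WeakDual.toStrongDual l), s, hs, fun v => ?_⟩
  have := (WeakBilin.tendsto_iff_forall_eval_tendsto _ ContinuousLinearMap.coe_injective).1 hl v
  simp only [InnerProductSpace.toDual_symm_apply]
  exact this

end WeakCompactness

/-- Separability is what sequential Banach–Alaoglu asks of H¹(Ω); it comes from that of L², whose
exponent is finite. -/
instance {d : ℕ} {Ω : Set (Euc d)} : SecondCountableTopology (H1 Ω) := by
  have : Fact ((2 : ℝ≥0∞) ≠ ⊤) := ⟨by simp⟩
  have : SecondCountableTopology (L2 Ω ℝ) := inferInstance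
  have : SecondCountableTopology (L2 Ω (Euc d)) := inferInstance
  have : SecondCountableTopology (WithLp 2 (L2 Ω ℝ × L2 Ω (Euc d))) :=
    (WithLp.homeomorphProd 2 (L2 Ω ℝ) (L2 Ω (Euc d))).secondCountableTopology
  exact TopologicalSpace.Subtype.secondCountableTopology _

/-! ### A translation estimate for compactly supported functions. -/

section Autocorrelation

variable {E : Type*} [NormedAddCommGroup E] [NormedSpace ℝ E] [MeasurableSpace E] [BorelSpace E]
  {μ : Measure E} [μ.IsAddHaarMeasure]

/-- Differentiation under the integral: the derivative falls on the translated factor only, and the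
integrand is dominated by |ψ| times a bound for the derivative of ψ. -/
theorem hasDerivAt_integral_mul_translate {ψ : E → ℝ} (hψ : ContDiff ℝ 1 ψ)
    (hc : HasCompactSupport ψ) (h : E) (t : ℝ) :
    HasDerivAt (fun t : ℝ => ∫ x, ψ x * ψ (x + t • h) ∂μ)
      (∫ x, ψ x * fderiv ℝ ψ (x + t • h) h ∂μ) t := by
  have cψ := hψ.continuous
  have cψ' := hψ.continuous_fderiv one_ne_zero
  obtain ⟨C, hC⟩ := (hc.fderiv ℝ).exists_bound_of_continuous cψ'
  have iψ : Integrable ψ μ := cψ.integrable_of_hasCompactSupport hc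
  have hadd : ∀ t : ℝ, Continuous fun x : E => x + t • h := fun t => by fun_prop
  refine (hasDerivAt_integral_of_dominated_loc_of_deriv_le (F := fun t x => ψ x * ψ (x + t • h))
    (F' := fun t x => ψ x * fderiv ℝ ψ (x + t • h) h) (bound := fun x => ‖ψ x‖ * (C * ‖h‖))
    univ_mem ?_ ?_ ?_ ?_ ?_ ?_).2
  · exact Eventually.of_forall fun t =>
      (cψ.mul (cψ.comp (hadd t))).aestronglyMeasurable
  · exact (cψ.mul (cψ.comp (hadd t))).integrable_of_hasCompactSupport hc.mul_right
  · exact (cψ.mul ((cψ'.comp (hadd t)).clm_apply continuous_const)).aestronglyMeasurable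
  · refine ae_of_all _ fun x t _ => ?_
    rw [norm_mul]
    gcongr
    exact (ContinuousLinearMap.le_opNorm _ _).trans (by gcongr; exact hC _)
  · exact iψ.norm.mul_const _
  · refine ae_of_all _ fun x t _ => ?_
    have h1 : HasDerivAt (fun t : ℝ => x + t • h) h t := by
      simpa using ((hasDerivAt_id t).smul_const h).const_add x
    have h2 := ((hψ.differentiable one_ne_zero) (x + t • h)).hasFDerivAt
    exact (h2.comp_hasDerivAt t h1).const_mul (ψ x)

/-- The autocorrelation of a compactly supported `C¹` function varies at most linearly. -/
theorem integral_sq_sub_integral_mul_translate_le [FiniteDimensional ℝ E] {ψ : E → ℝ}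
    (hψ : ContDiff ℝ 1 ψ)
    (hc : HasCompactSupport ψ) (h : E) :
    (∫ x, ψ x ^ 2 ∂μ) - ∫ x, ψ x * ψ (x + h) ∂μ ≤
      ‖h‖ / 2 * ((∫ x, ψ x ^ 2 ∂μ) + ∫ x, ‖fderiv ℝ ψ x‖ ^ 2 ∂μ) := by
  have cψ := hψ.continuous
  have cψ' := hψ.continuous_fderiv one_ne_zero
  have hc' := hc.fderiv ℝ
  have i2 : Integrable (fun x => ψ x ^ 2) μ := by
    simp only [sq]
    exact (cψ.mul cψ).integrable_of_hasCompactSupport hc.mul_left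
  have i3 : Integrable (fun x => ‖fderiv ℝ ψ x‖ ^ 2) μ := by
    simp only [sq]
    exact (cψ'.norm.mul cψ'.norm).integrable_of_hasCompactSupport hc'.norm.mul_left
  -- Young's inequality and translation invariance make the bound independent of t, so the mean
  -- value inequality on [0, 1] finishes.
  have hbd : ∀ t : ℝ, ‖∫ x, ψ x * fderiv ℝ ψ (x + t • h) h ∂μ‖ ≤
      ‖h‖ / 2 * ((∫ x, ψ x ^ 2 ∂μ) + ∫ x, ‖fderiv ℝ ψ x‖ ^ 2 ∂μ) := by
    intro t
    have i3' : Integrable (fun x => ‖fderiv ℝ ψ (x + t • h)‖ ^ 2) μ := i3.comp_add_right (t • h)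
    calc ‖∫ x, ψ x * fderiv ℝ ψ (x + t • h) h ∂μ‖
        ≤ ∫ x, ‖h‖ / 2 * (ψ x ^ 2 + ‖fderiv ℝ ψ (x + t • h)‖ ^ 2) ∂μ := by
          refine norm_integral_le_of_norm_le ((i2.add i3').const_mul _) (ae_of_all _ fun x => ?_)
          have h1 := ContinuousLinearMap.le_opNorm (fderiv ℝ ψ (x + t • h)) h
          rw [norm_mul]
          have h2 : ‖ψ x‖ ^ 2 = ψ x ^ 2 := by simp
          calc ‖ψ x‖ * ‖fderiv ℝ ψ (x + t • h) h‖
              ≤ ‖ψ x‖ * (‖fderiv ℝ ψ (x + t • h)‖ * ‖h‖) := by gcongr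
            _ = ‖h‖ / 2 * (2 * ‖ψ x‖ * ‖fderiv ℝ ψ (x + t • h)‖) := by ring
            _ ≤ ‖h‖ / 2 * (‖ψ x‖ ^ 2 + ‖fderiv ℝ ψ (x + t • h)‖ ^ 2) := by
              gcongr
              exact two_mul_le_add_sq _ _
            _ = _ := by rw [h2]
      _ = _ := by
          rw [integral_const_mul, integral_add i2 i3',
            integral_add_right_eq_self (fun x => ‖fderiv ℝ ψ x‖ ^ 2) (t • h)]
  have := norm_image_sub_le_of_norm_deriv_le_segment_01'
    (f := fun t : ℝ => ∫ x, ψ x * ψ (x + t • h) ∂μ)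
    (fun t _ => (hasDerivAt_integral_mul_translate hψ hc h t).hasDerivWithinAt)
    (fun t _ => hbd t)
  simp only [one_smul, zero_smul, add_zero, Real.norm_eq_abs] at this
  have h3 := (abs_le.1 this).1
  simp_rw [← sq] at h3
  linarith

end Autocorrelation

/-! ### Compact embedding of H¹₀(Ω) into L²(Ω). -/

section Rellich

variable {d : ℕ} {Ω : Set (Euc d)}

theorem IsTest.norm_toH1_sq {ψ : Euc d → ℝ} (h : IsTest Ω ψ) :
    ‖h.toH1‖ ^ 2 = (∫ x, ψ x ^ 2) + ∫ x, ‖fderiv ℝ ψ x‖ ^ 2 := by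
  rw [H1.norm_sq, L2.norm_sq_eq_integral, ← real_inner_self_eq_norm_sq,
    L2.inner_eq_integral_inner]
  congr 1
  · rw [← setIntegral_eq_integral_of_forall_compl_eq_zero (s := Ω) (f := fun x => ψ x ^ 2)
      fun x hx => by rw [h.eq_zero_of_notMem hx, zero_pow two_ne_zero]]
    refine integral_congr_ae ?_
    filter_upwards [h.toH1_fn] with x hx
    rw [hx]
  · have : ∀ x, ‖fderiv ℝ ψ x‖ = ‖gradient ψ x‖ := fun x => by simp [gradient]
    simp_rw [this]
    rw [← setIntegral_eq_integral_of_forall_compl_eq_zero (s := Ω)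
      (f := fun x => ‖gradient ψ x‖ ^ 2) fun x hx => by rw [h.gradient_eq_zero_of_notMem hx]; simp]
    refine integral_congr_ae ?_
    filter_upwards [h.toH1_grad] with x hx
    rw [hx, real_inner_self_eq_norm_sq]

/-- The local averages of a function control its `L²` norm up to its Sobolev norm. -/
theorem integral_sq_le_of_local_average (hb : Bornology.IsBounded Ω)
    {ψ : Euc d → ℝ} (hψ : IsTest Ω ψ) {δ : ℝ} (hδ : 0 < δ) :
    ∫ x, ψ x ^ 2 ≤ (volume.real (Metric.ball (0 : Euc d) δ))⁻¹ ^ 2 *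
      (∫ x in Ω, (∫ h in Metric.ball (0 : Euc d) δ, ψ (x + h)) ^ 2) + δ * ‖hψ.toH1‖ ^ 2 := by
  set B := Metric.ball (0 : Euc d) δ
  set v := volume.real B
  have hv : 0 < v := ENNReal.toReal_pos (Metric.measure_ball_pos _ _ hδ).ne' measure_ball_lt_top.ne
  have cψ := hψ.1.continuous
  obtain ⟨C, hC⟩ := hψ.2.1.exists_bound_of_continuous cψ
  have : IsFiniteMeasure ((volume : Measure (Euc d)).restrict Ω) :=
    ⟨by simpa using hb.measure_lt_top⟩
  have : IsFiniteMeasure ((volume : Measure (Euc d)).restrict B) :=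
    ⟨by simpa using measure_ball_lt_top⟩
  have hprod : Integrable (fun p : Euc d × Euc d => ψ p.1 * ψ (p.1 + p.2))
      ((volume.restrict Ω).prod (volume.restrict B)) := by
    refine Integrable.of_bound (C := C * C) ?_ (ae_of_all _ fun p => ?_)
    · exact Continuous.aestronglyMeasurable (by fun_prop)
    · rw [norm_mul]
      exact mul_le_mul (hC _) (hC _) (norm_nonneg _) ((norm_nonneg _).trans (hC p.1))
  have hm : ∀ x, ‖∫ h in B, ψ (x + h)‖ ≤ C * v := fun x =>
    norm_setIntegral_le_of_norm_le_const measure_ball_lt_top fun h _ => hC _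
  have cm : AEStronglyMeasurable (fun x => ∫ h in B, ψ (x + h)) (volume.restrict Ω) := by
    have : StronglyMeasurable fun p : Euc d × Euc d => ψ (p.1 + p.2) :=
      Continuous.stronglyMeasurable (by fun_prop)
    exact this.integral_prod_right.aestronglyMeasurable
  have im : Integrable (fun x => (∫ h in B, ψ (x + h)) ^ 2) (volume.restrict Ω) := by
    refine Integrable.of_bound (C := (C * v) ^ 2) (cm.pow 2) (ae_of_all _ fun x => ?_)
    rw [norm_pow]
    exact pow_le_pow_left₀ (norm_nonneg _) (hm x) 2
  have i2 : Integrable (fun x => ψ x ^ 2) (volume.restrict Ω) := hψ.memLp.integrable_sq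
  have e2 : ∫ x in Ω, ψ x ^ 2 = ∫ x, ψ x ^ 2 :=
    setIntegral_eq_integral_of_forall_compl_eq_zero fun x hx => by
      rw [hψ.eq_zero_of_notMem hx, zero_pow two_ne_zero]
  have h1 : ∀ h ∈ B, ∫ x, ψ x ^ 2 ≤
      (∫ x in Ω, ψ x * ψ (x + h)) + δ / 2 * ‖hψ.toH1‖ ^ 2 := by
    intro h hh
    have := integral_sq_sub_integral_mul_translate_le (μ := volume)
      (hψ.1.of_le (by exact_mod_cast le_top)) hψ.2.1 h
    rw [← hψ.norm_toH1_sq] at this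
    rw [setIntegral_eq_integral_of_forall_compl_eq_zero fun x hx => by
      rw [hψ.eq_zero_of_notMem hx, zero_mul]]
    have hh' : ‖h‖ ≤ δ := (mem_ball_zero_iff.1 hh).le
    have : ‖h‖ / 2 * ‖hψ.toH1‖ ^ 2 ≤ δ / 2 * ‖hψ.toH1‖ ^ 2 := by gcongr
    linarith
  -- The translation estimate is integrated over all shifts in the ball; Fubini turns the
  -- correlations into a pairing of ψ with its local averages.
  have h2 : v * ∫ x, ψ x ^ 2 ≤
      (∫ x in Ω, ψ x * ∫ h in B, ψ (x + h)) + v * (δ / 2 * ‖hψ.toH1‖ ^ 2) := by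
    have hi : Integrable (fun h => ∫ x in Ω, ψ x * ψ (x + h)) (volume.restrict B) :=
      hprod.integral_prod_right
    have := setIntegral_mono_on (integrable_const _) (hi.add (integrable_const _))
      measurableSet_ball h1
    simp only [Pi.add_apply] at this
    rw [integral_add hi (integrable_const _)] at this
    simp only [integral_const, measureReal_restrict_apply_univ, smul_eq_mul] at this
    refine this.trans_eq ?_
    congr 1
    have := integral_integral_swap (f := fun x h => ψ x * ψ (x + h)) hprod
    simp_rw [integral_const_mul] at this
    exact this.symm
  -- Young's inequality, weighted so that the ψ² term is half of the left side of `h2` and can be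
  -- absorbed there.
  have h3 : ∫ x in Ω, ψ x * ∫ h in B, ψ (x + h) ≤
      v / 2 * (∫ x, ψ x ^ 2) + (2 * v)⁻¹ * ∫ x in Ω, (∫ h in B, ψ (x + h)) ^ 2 := by
    rw [← e2, ← integral_const_mul, ← integral_const_mul,
      ← integral_add (i2.const_mul _) (im.const_mul _)]
    refine integral_mono ?_ ((i2.const_mul _).add (im.const_mul _)) fun x => ?_
    · have := hprod.integral_prod_left
      simpa only [integral_const_mul] using this
    · set m := ∫ h in B, ψ (x + h)
      have : v / 2 * ψ x ^ 2 + (2 * v)⁻¹ * m ^ 2 - ψ x * m = (2 * v)⁻¹ * (v * ψ x - m) ^ 2 := by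
        field_simp; ring
      have h0 : 0 ≤ (2 * v)⁻¹ * (v * ψ x - m) ^ 2 := by positivity
      simp only
      linarith
  set I := ∫ x, ψ x ^ 2
  set J := ∫ x in Ω, (∫ h in B, ψ (x + h)) ^ 2
  have h4 : v / 2 * I ≤ (2 * v)⁻¹ * J + v * (δ / 2 * ‖hψ.toH1‖ ^ 2) := by linarith
  have h5 : v / 2 * (v⁻¹ ^ 2 * J + δ * ‖hψ.toH1‖ ^ 2) =
      (2 * v)⁻¹ * J + v * (δ / 2 * ‖hψ.toH1‖ ^ 2) := by
    field_simp
  rw [← h5] at h4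
  exact le_of_mul_le_mul_left h4 (by positivity)

/-- Rellich's theorem for weakly null sequences of test functions. -/
theorem tendsto_integral_sq_of_tendsto_inner_zero
    (hb : Bornology.IsBounded Ω) {ψ : ℕ → Euc d → ℝ} (hψ : ∀ k, IsTest Ω (ψ k)) {C : ℝ}
    (hC : ∀ k, ‖(hψ k).toH1‖ ≤ C)
    (hw : ∀ f : L2 Ω ℝ, Tendsto (fun k => ⟪(hψ k).toH1.fn, f⟫) atTop (𝓝 0)) :
    Tendsto (fun k => ∫ x, ψ k x ^ 2) atTop (𝓝 0) := by
  have hC0 : 0 ≤ C := (norm_nonneg _).trans (hC 0)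
  have hfin : IsFiniteMeasure ((volume : Measure (Euc d)).restrict Ω) :=
    ⟨by simpa using hb.measure_lt_top⟩
  -- At fixed radius a local average is a pairing with a fixed indicator: it tends to 0 pointwise by
  -- weak convergence and is bounded by Cauchy–Schwarz, and Ω has finite measure.
  have hlim : ∀ δ > 0, Tendsto
      (fun k => ∫ x in Ω, (∫ h in Metric.ball (0 : Euc d) δ, ψ k (x + h)) ^ 2) atTop (𝓝 0) := by
    intro δ hδ
    have hball : ∀ (k : ℕ) (x : Euc d), ∫ h in Metric.ball (0 : Euc d) δ, ψ k (x + h) =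
        ⟪(hψ k).toH1.fn, indicatorConstLp 2 (measurableSet_ball (x := x) (ε := δ))
          (measure_ne_top (volume.restrict Ω) _) (1 : ℝ)⟫ := by
      intro k x
      rw [real_inner_comm, L2.inner_indicatorConstLp_one]
      have h1 : ∫ h in Metric.ball (0 : Euc d) δ, ψ k (x + h) = ∫ y in Metric.ball x δ, ψ k y := by
        rw [← integral_indicator measurableSet_ball, ← integral_indicator measurableSet_ball,
          ← integral_add_left_eq_self ((Metric.ball x δ).indicator _) x]
        refine integral_congr_ae (ae_of_all _ fun h => ?_)
        simp [indicator, Metric.mem_ball, dist_eq_norm]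
      have h2 : ∫ y in Metric.ball x δ, (hψ k).toH1.fn y ∂volume.restrict Ω =
          ∫ y in Metric.ball x δ, ψ k y ∂volume.restrict Ω :=
        integral_congr_ae (ae_restrict_of_ae (hψ k).toH1_fn)
      rw [h1, h2, ← integral_indicator measurableSet_ball, ← integral_indicator measurableSet_ball,
        setIntegral_eq_integral_of_forall_compl_eq_zero fun y hy => by
          simp [indicator, (hψ k).eq_zero_of_notMem hy]]
    have hbd : ∀ (k : ℕ) (x : Euc d), ‖∫ h in Metric.ball (0 : Euc d) δ, ψ k (x + h)‖ ≤
        C * volume.real Ω ^ (1 / 2 : ℝ) := by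
      intro k x
      rw [hball]
      refine (norm_inner_le_norm _ _).trans ?_
      gcongr
      · exact (H1.norm_fn_le _).trans (hC k)
      · refine norm_indicatorConstLp_le.trans ?_
        rw [norm_one, one_mul]
        simp only [ENNReal.toReal_ofNat]
        refine Real.rpow_le_rpow measureReal_nonneg ?_ (by norm_num)
        rw [← measureReal_restrict_apply_univ Ω]
        exact measureReal_mono (subset_univ _)
    have := tendsto_integral_of_dominated_convergence (μ := volume.restrict Ω)
      (F := fun k x => (∫ h in Metric.ball (0 : Euc d) δ, ψ k (x + h)) ^ 2) (f := fun _ => 0)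
      (fun _ => (C * volume.real Ω ^ (1 / 2 : ℝ)) ^ 2) ?_ (integrable_const _) ?_ ?_
    · simpa using this
    · intro k
      have : StronglyMeasurable fun p : Euc d × Euc d => ψ k (p.1 + p.2) :=
        ((hψ k).1.continuous.comp (by fun_prop)).stronglyMeasurable
      exact (this.integral_prod_right.aestronglyMeasurable).pow 2
    · refine fun k => ae_of_all _ fun x => ?_
      rw [norm_pow]
      exact pow_le_pow_left₀ (norm_nonneg _) (hbd k x) 2
    · refine ae_of_all _ fun x => ?_
      simp_rw [hball]
      simpa using (hw _).pow 2
  rw [Metric.tendsto_atTop]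
  intro r hr
  -- The radius is fixed first, making the Sobolev error small uniformly in k; only then is k taken
  -- large.
  obtain ⟨δ, hδ, hδr⟩ : ∃ δ > 0, δ * C ^ 2 < r / 2 := by
    refine ⟨r / (4 * (C ^ 2 + 1)), by positivity, ?_⟩
    rw [div_mul_eq_mul_div, div_lt_iff₀ (by positivity)]
    nlinarith [sq_nonneg C]
  have h1 := ((hlim δ hδ).const_mul ((volume.real (Metric.ball (0 : Euc d) δ))⁻¹ ^ 2))
  rw [mul_zero] at h1
  obtain ⟨N, hN⟩ := eventually_atTop.1 (h1.eventually_lt_const (half_pos hr))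
  refine ⟨N, fun k hk => ?_⟩
  have h2 := integral_sq_le_of_local_average hb (hψ k) hδ
  have h3 : δ * ‖(hψ k).toH1‖ ^ 2 ≤ δ * C ^ 2 := by
    gcongr
    exact hC k
  rw [Real.dist_eq, sub_zero, abs_of_nonneg (integral_nonneg fun x => sq_nonneg _)]
  linarith [hN k hk]

/-- **Rellich's theorem**: weakly convergent sequences in `H¹₀` converge in `L²`. -/
theorem tendsto_fn_of_tendsto_inner (hΩ : IsOpen Ω) (hb : Bornology.IsBounded Ω)
    {w : ℕ → H1 Ω} {u : H1 Ω} (hw : ∀ k, w k ∈ H10 Ω) (hu : u ∈ H10 Ω) {C : ℝ}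
    (hC : ∀ k, ‖w k‖ ≤ C) (hwu : ∀ v, Tendsto (fun k => ⟪w k, v⟫) atTop (𝓝 ⟪u, v⟫)) :
    Tendsto (fun k => (w k).fn) atTop (𝓝 u.fn) := by
  have hd : ∀ k, w k - u ∈ H10 Ω := fun k => (H10Submodule Ω).sub_mem (hw k) hu
  -- The differences are replaced by test functions at distance below 1/(k+1), which changes neither
  -- the weak limit nor the L² limit.
  choose ψ hψ hψd using fun k : ℕ =>
    exists_isTest_norm_sub_lt hΩ (hd k) (Nat.one_div_pos_of_nat (α := ℝ) (n := k))
  have hdiff : Tendsto (fun k => ‖w k - u - (hψ k).toH1‖) atTop (𝓝 0) :=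
    squeeze_zero (fun _ => norm_nonneg _) (fun k => (hψd k).le)
      tendsto_one_div_add_atTop_nhds_zero_nat
  have hw0 : ∀ v, Tendsto (fun k => ⟪(hψ k).toH1, v⟫) atTop (𝓝 0) := by
    intro v
    have h1 : Tendsto (fun k => ⟪w k - u - (hψ k).toH1, v⟫) atTop (𝓝 0) :=
      squeeze_zero_norm (fun k => norm_inner_le_norm _ _) (by simpa using hdiff.mul_const ‖v‖)
    have h2 : Tendsto (fun k => ⟪w k - u, v⟫) atTop (𝓝 0) := by
      simp_rw [inner_sub_left]
      simpa using (hwu v).sub_const ⟪u, v⟫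
    have h3 := h2.sub h1
    rw [sub_zero] at h3
    refine h3.congr fun k => ?_
    rw [inner_sub_left (w k - u)]
    ring
  -- The adjoint of the embedding turns L² pairings into H¹ pairings, so weak convergence in H¹
  -- yields it in L².
  let T : H1 Ω →L[ℝ] L2 Ω ℝ := ⟨⟨⟨H1.fn, H1.fn_add⟩, H1.fn_smul⟩, H1.continuous_fn⟩
  have hf0 : ∀ f : L2 Ω ℝ, Tendsto (fun k => ⟪(hψ k).toH1.fn, f⟫) atTop (𝓝 0) := by
    intro f
    refine (hw0 (ContinuousLinearMap.adjoint T f)).congr fun k => ?_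
    rw [ContinuousLinearMap.adjoint_inner_right]
    rfl
  have hbd : ∀ k, ‖(hψ k).toH1‖ ≤ 1 + (C + ‖u‖) := by
    intro k
    have h1 : ‖(hψ k).toH1‖ ≤ ‖w k - u - (hψ k).toH1‖ + ‖w k - u‖ := by
      rw [← norm_neg (w k - u - _)]
      simpa using norm_add_le (-(w k - u - (hψ k).toH1)) (w k - u)
    have h2 : ‖w k - u - (hψ k).toH1‖ ≤ 1 := (hψd k).le.trans (by
      rw [div_le_one (by positivity)]
      linarith [k.cast_nonneg (α := ℝ)])
    linarith [norm_sub_le (w k) u, hC k]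
  have h0 := tendsto_integral_sq_of_tendsto_inner_zero hb hψ hbd hf0
  have h1 : Tendsto (fun k => ‖(hψ k).toH1.fn‖) atTop (𝓝 0) := by
    have := h0.sqrt
    rw [Real.sqrt_zero] at this
    refine this.congr fun k => ?_
    rw [← Real.sqrt_sq (norm_nonneg _), L2.norm_sq_eq_integral,
      ← setIntegral_eq_integral_of_forall_compl_eq_zero (s := Ω) fun x hx => by
        rw [(hψ k).eq_zero_of_notMem hx, zero_pow two_ne_zero]]
    congr 1
    refine integral_congr_ae ?_
    filter_upwards [(hψ k).toH1_fn] with x hx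
    rw [hx]
  rw [tendsto_iff_norm_sub_tendsto_zero]
  refine squeeze_zero (fun _ => norm_nonneg _) (fun k => ?_) (by simpa using hdiff.add h1)
  have h2 : (w k).fn - u.fn = (w k - u - (hψ k).toH1).fn + (hψ k).toH1.fn := by simp
  rw [h2]
  exact (norm_add_le _ _).trans (by gcongr; exact H1.norm_fn_le _)

/-- Bounded sequences in `H¹₀` have subsequences converging weakly in `H¹` and strongly in
`L²`. -/
theorem exists_subseq_tendsto (hΩ : IsOpen Ω) (hb : Bornology.IsBounded Ω)
    {w : ℕ → H1 Ω} (hw : ∀ k, w k ∈ H10 Ω) {C : ℝ} (hC : ∀ k, ‖w k‖ ≤ C) :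
    ∃ (u : H1 Ω) (s : ℕ → ℕ), StrictMono s ∧ u ∈ H10 Ω ∧
      (∀ v, Tendsto (fun n => ⟪w (s n), v⟫) atTop (𝓝 ⟪u, v⟫)) ∧
      Tendsto (fun k => (w (s k)).fn) atTop (𝓝 u.fn) := by
  obtain ⟨u, s, hs, hu⟩ := exists_subseq_tendsto_inner hC
  have hu0 : u ∈ H10 Ω := (H10Submodule Ω).mem_of_tendsto_inner isClosed_closure
    (fun n => hw (s n)) hu
  exact ⟨u, s, hs, hu0, hu, tendsto_fn_of_tendsto_inner hΩ hb (fun k => hw (s k)) hu0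
    (fun k => hC (s k)) hu⟩

end Rellich

/-! ### Smooth chain rule in H¹₀(Ω) and density of bounded functions. -/

section Truncation

variable {d : ℕ} {Ω : Set (Euc d)}

/-- Dominated convergence in `L²`. -/
theorem L2.tendsto_of_dominated {F : Type} [NormedAddCommGroup F] [InnerProductSpace ℝ F]
    {f : ℕ → L2 Ω F} {f₀ : L2 Ω F} {g : Euc d → ℝ} (hg : MemLp g 2 (volume.restrict Ω))
    (hfg : ∀ n, ∀ᵐ x ∂(volume.restrict Ω), ‖f n x - f₀ x‖ ≤ g x)
    (hf : ∀ᵐ x ∂(volume.restrict Ω), Tendsto (fun n => f n x) atTop (𝓝 (f₀ x))) :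
    Tendsto f atTop (𝓝 f₀) := by
  have h : Tendsto (fun n => ∫ x in Ω, ‖f n x - f₀ x‖ ^ 2) atTop (𝓝 (∫ _ in Ω, (0 : ℝ))) := by
    refine tendsto_integral_of_dominated_convergence (fun x => g x ^ 2) (fun n => ?_)
      hg.integrable_sq (fun n => ?_) ?_
    · exact (((Lp.aestronglyMeasurable (f n)).sub (Lp.aestronglyMeasurable f₀)).norm).pow 2
    · filter_upwards [hfg n] with x hx
      rw [norm_pow, norm_norm]
      exact pow_le_pow_left₀ (norm_nonneg _) hx 2
    · filter_upwards [hf] with x hx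
      have := ((tendsto_iff_norm_sub_tendsto_zero.1 hx).pow 2)
      simpa using this
  rw [integral_zero] at h
  rw [tendsto_iff_norm_sub_tendsto_zero]
  have h2 := h.sqrt
  rw [Real.sqrt_zero] at h2
  refine h2.congr fun n => ?_
  rw [← Real.sqrt_sq (norm_nonneg (f n - f₀)), ← real_inner_self_eq_norm_sq,
    MeasureTheory.L2.inner_def]
  congr 1
  refine integral_congr_ae ?_
  filter_upwards [Lp.coeFn_sub (f n) f₀] with x hx
  rw [hx, real_inner_self_eq_norm_sq, Pi.sub_apply]

theorem L2.exists_subseq_tendsto_ae {F : Type} [NormedAddCommGroup F] {f : ℕ → L2 Ω F}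
    {f₀ : L2 Ω F} (hf : Tendsto f atTop (𝓝 f₀)) : ∃ s : ℕ → ℕ, StrictMono s ∧
      ∀ᵐ x ∂(volume.restrict Ω), Tendsto (fun n => f (s n) x) atTop (𝓝 (f₀ x)) :=
  (tendstoInMeasure_of_tendsto_Lp hf).exists_seq_tendsto_ae

theorem H1.memLp_comp {F : ℝ → ℝ} (hF : LipschitzWith 1 F) (h0 : F 0 = 0) (u : H1 Ω) :
    MemLp (fun x => F (u.fn x)) 2 (volume.restrict Ω) := by
  refine (Lp.memLp u.fn).of_le (hF.continuous.comp_aestronglyMeasurable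
    (Lp.aestronglyMeasurable u.fn)) (ae_of_all _ fun x => ?_)
  simpa [h0] using hF.norm_sub_le (u.fn x) 0

theorem H1.memLp_smul_grad {F : ℝ → ℝ} (hF : Continuous F) {C : ℝ} (hC : ∀ t, |F t| ≤ C)
    (u : H1 Ω) : MemLp (fun x => F (u.fn x) • u.grad x) 2 (volume.restrict Ω) := by
  refine (Lp.memLp u.grad).of_le_mul (c := C) ((hF.comp_aestronglyMeasurable
    (Lp.aestronglyMeasurable u.fn)).smul (Lp.aestronglyMeasurable u.grad))
    (ae_of_all _ fun x => ?_)
  rw [norm_smul]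
  gcongr
  exact hC _

theorem IsTest.comp {ψ : Euc d → ℝ} (h : IsTest Ω ψ) {F : ℝ → ℝ}
    (hF : ContDiff ℝ (⊤ : ℕ∞) F) (h0 : F 0 = 0) : IsTest Ω fun x => F (ψ x) :=
  ⟨hF.comp h.1, h.2.1.comp_left h0, (closure_mono (Function.support_comp_subset h0 ψ)).trans h.2.2⟩

theorem IsTest.gradient_comp {ψ : Euc d → ℝ} (h : IsTest Ω ψ) {F : ℝ → ℝ}
    (hF : ContDiff ℝ (⊤ : ℕ∞) F) (x : Euc d) :
    gradient (fun x => F (ψ x)) x = deriv F (ψ x) • gradient ψ x := by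
  have h1 := ((hF.differentiable (by simp)) (ψ x)).hasDerivAt.comp_hasFDerivAt x
    ((h.1.differentiable (by simp)) x).hasFDerivAt
  have h2 : fderiv ℝ (fun x => F (ψ x)) x = deriv F (ψ x) • fderiv ℝ ψ x := h1.fderiv
  simp only [gradient, h2]
  exact map_smulₛₗ _ _ _ |>.trans (by simp)

/-- The chain rule in `H¹₀`. -/
theorem exists_comp_mem_H10 (hΩ : IsOpen Ω) {u : H1 Ω} (hu : u ∈ H10 Ω) {F : ℝ → ℝ}
    (hF : ContDiff ℝ (⊤ : ℕ∞) F) (h0 : F 0 = 0) (hL : ∀ t, |deriv F t| ≤ 1) :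
    ∃ v ∈ H10 Ω, v.fn =ᵐ[volume.restrict Ω] (fun x => F (u.fn x)) ∧
      v.grad =ᵐ[volume.restrict Ω] fun x => deriv F (u.fn x) • u.grad x := by
  have hLip : LipschitzWith 1 F :=
    lipschitzWith_of_nnnorm_deriv_le (hF.differentiable (by simp)) fun t => by
      rw [← NNReal.coe_le_coe]; simpa using hL t
  have cF' : Continuous (deriv F) := hF.continuous_deriv (by simp)
  choose ψ hψ hψu using fun k : ℕ =>
    exists_isTest_norm_sub_lt hΩ hu (Nat.one_div_pos_of_nat (α := ℝ) (n := k))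
  have hlim : Tendsto (fun k => (hψ k).toH1) atTop (𝓝 u) := by
    rw [tendsto_iff_norm_sub_tendsto_zero]
    refine squeeze_zero (fun _ => norm_nonneg _) (fun k => ?_)
      tendsto_one_div_add_atTop_nhds_zero_nat
    rw [norm_sub_rev]
    exact (hψu k).le
  obtain ⟨s, hs, hae⟩ := L2.exists_subseq_tendsto_ae
    ((H1.continuous_fn.tendsto u).comp hlim)
  set f₀ : L2 Ω ℝ := (H1.memLp_comp hLip h0 u).toLp
  set g₀ : L2 Ω (Euc d) := (H1.memLp_smul_grad cF' hL u).toLp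
  have hf₀ : f₀ =ᵐ[volume.restrict Ω] fun x => F (u.fn x) := MemLp.coeFn_toLp _
  have hg₀ : g₀ =ᵐ[volume.restrict Ω] fun x => deriv F (u.fn x) • u.grad x := MemLp.coeFn_toLp _
  set v : ℕ → H1 Ω := fun k => ((hψ (s k)).comp hF h0).toH1
  have hv : ∀ k, v k ∈ H10 Ω := fun k => IsTest.toH1_mem _
  have hvf : ∀ k, (v k).fn =ᵐ[volume.restrict Ω] fun x => F ((hψ (s k)).toH1.fn x) := by
    intro k
    filter_upwards [((hψ (s k)).comp hF h0).toH1_fn, (hψ (s k)).toH1_fn] with x h1 h2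
    rw [h1, h2]
  have hvg : ∀ k, (v k).grad =ᵐ[volume.restrict Ω]
      fun x => deriv F ((hψ (s k)).toH1.fn x) • (hψ (s k)).toH1.grad x := by
    intro k
    filter_upwards [((hψ (s k)).comp hF h0).toH1_grad, (hψ (s k)).toH1_fn, (hψ (s k)).toH1_grad]
      with x h1 h2 h3
    rw [h1, h2, h3, (hψ (s k)).gradient_comp hF]
  have hlim' : Tendsto (fun k => (hψ (s k)).toH1) atTop (𝓝 u) := hlim.comp hs.tendsto_atTop
  have tf : Tendsto (fun k => (v k).fn) atTop (𝓝 f₀) := by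
    have h1 := tendsto_iff_norm_sub_tendsto_zero.1 ((H1.continuous_fn.tendsto u).comp hlim')
    rw [tendsto_iff_norm_sub_tendsto_zero]
    refine squeeze_zero (fun _ => norm_nonneg _) (fun k => ?_) h1
    refine Lp.norm_le_norm_of_ae_le ?_
    filter_upwards [hvf k, hf₀, Lp.coeFn_sub (v k).fn f₀,
      Lp.coeFn_sub (hψ (s k)).toH1.fn u.fn] with x h1 h2 h3 h4
    simp only [Function.comp_apply]
    rw [h3, h4, Pi.sub_apply, Pi.sub_apply, h1, h2]
    simpa using hLip.norm_sub_le ((hψ (s k)).toH1.fn x) (u.fn x)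
  have tg : Tendsto (fun k => (v k).grad) atTop (𝓝 g₀) := by
    -- The hybrid F'(ψ_k)∇u separates the two errors: replacing F'(ψ_k) by F'(u) is dominated
    -- convergence along the a.e. convergent subsequence, and replacing ∇ψ_k by ∇u is controlled in
    -- norm by |F'| ≤ 1.
    have hm : ∀ k, MemLp (fun x => deriv F ((hψ (s k)).toH1.fn x) • u.grad x) 2
        (volume.restrict Ω) := fun k =>
      (Lp.memLp u.grad).of_le_mul (c := 1) ((cF'.comp_aestronglyMeasurable
        (Lp.aestronglyMeasurable _)).smul (Lp.aestronglyMeasurable u.grad))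
        (ae_of_all _ fun x => by
          rw [norm_smul]
          gcongr
          exact hL _)
    have t1 : Tendsto (fun k => (hm k).toLp) atTop (𝓝 g₀) := by
      refine L2.tendsto_of_dominated ((Lp.memLp u.grad).norm.const_mul 2) (fun k => ?_) ?_
      · filter_upwards [(hm k).coeFn_toLp, hg₀] with x h1 h2
        rw [h1, h2, ← sub_smul, norm_smul]
        gcongr
        have := norm_sub_le (deriv F ((hψ (s k)).toH1.fn x)) (deriv F (u.fn x))
        have h3 := hL ((hψ (s k)).toH1.fn x)
        have h4 := hL (u.fn x)
        simp only [Real.norm_eq_abs] at this ⊢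
        linarith
      · filter_upwards [ae_all_iff.2 fun k => (hm k).coeFn_toLp, hg₀, hae] with x h1 h2 h3
        simp_rw [h1]
        rw [h2]
        exact ((cF'.tendsto _).comp h3).smul_const _
    have t2 : Tendsto (fun k => (v k).grad - (hm k).toLp) atTop (𝓝 0) := by
      have h1 := tendsto_iff_norm_sub_tendsto_zero.1 ((H1.continuous_grad.tendsto u).comp hlim')
      rw [tendsto_zero_iff_norm_tendsto_zero]
      refine squeeze_zero (fun _ => norm_nonneg _) (fun k => ?_) h1
      refine Lp.norm_le_norm_of_ae_le ?_
      filter_upwards [hvg k, (hm k).coeFn_toLp, Lp.coeFn_sub (v k).grad (hm k).toLp,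
        Lp.coeFn_sub (hψ (s k)).toH1.grad u.grad] with x h1 h2 h3 h4
      simp only [Function.comp_apply]
      rw [h3, h4, Pi.sub_apply, Pi.sub_apply, h1, h2, ← smul_sub, norm_smul]
      exact mul_le_of_le_one_left (norm_nonneg _) (hL _)
    simpa using t2.add t1
  have hp : Tendsto (fun k => (v k).1) atTop
      (𝓝 (WithLp.toLp 2 (f₀, g₀) : WithLp 2 (L2 Ω ℝ × L2 Ω (Euc d)))) :=
    ((WithLp.prod_continuous_toLp 2 _ _).tendsto (f₀, g₀)).comp (tf.prodMk_nhds tg)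
  have hmem := isClosed_sobolevPairs.mem_of_tendsto hp (Eventually.of_forall fun k => (v k).2)
  refine ⟨⟨_, hmem⟩, ?_, hf₀, hg₀⟩
  exact isClosed_closure.mem_of_tendsto (tendsto_subtype_rng.2 hp) (Eventually.of_forall hv)

/-- Bounded functions are dense in `H¹₀`, and the approximation preserves zeros. -/
theorem exists_bounded_tendsto (hΩ : IsOpen Ω) {u : H1 Ω} (hu : u ∈ H10 Ω) :
    ∃ v : ℕ → H1 Ω, Tendsto v atTop (𝓝 u) ∧ ∀ n, v n ∈ H10 Ω ∧
      (∃ C, ∀ᵐ x ∂(volume.restrict Ω), |(v n).fn x| ≤ C) ∧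
      ∀ᵐ x ∂(volume.restrict Ω), u.fn x = 0 → (v n).fn x = 0 := by
  set M : ℕ → ℝ := fun n => n + 1
  have hM : ∀ n, 0 < M n := fun n => by positivity
  have hMt : Tendsto M atTop atTop := tendsto_atTop_add_const_right _ _ tendsto_natCast_atTop_atTop
  -- A smooth substitute for cutting off at height M: it is bounded by M, vanishes at 0, tends to
  -- the identity, and its derivative is a cosine, of modulus at most 1 and tending to 1. The smooth
  -- chain rule therefore suffices.
  set F : ℕ → ℝ → ℝ := fun n t => M n * Real.sin (t / M n)
  have hF : ∀ n, ContDiff ℝ (⊤ : ℕ∞) (F n) := fun n =>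
    contDiff_const.mul (Real.contDiff_sin.comp (contDiff_id.div_const _))
  have hd : ∀ n t, HasDerivAt (F n) (Real.cos (t / M n)) t := fun n t => by
    have := (((hasDerivAt_id t).div_const (M n)).sin).const_mul (M n)
    refine this.congr_deriv ?_
    have := (hM n).ne'
    simp only [id]
    field_simp
  have hd' : ∀ n t, deriv (F n) t = Real.cos (t / M n) := fun n t => (hd n t).deriv
  have hb : ∀ n t, |F n t| ≤ |t| := fun n t => by
    rw [abs_mul, abs_of_pos (hM n)]
    calc M n * |Real.sin (t / M n)| ≤ M n * |t / M n| :=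
          mul_le_mul_of_nonneg_left Real.abs_sin_le_abs (hM n).le
      _ = |t| := by rw [abs_div, abs_of_pos (hM n), mul_div_cancel₀ _ (hM n).ne']
  have hdiv : ∀ t : ℝ, Tendsto (fun n => t / M n) atTop (𝓝 0) := fun t =>
    tendsto_const_nhds.div_atTop hMt
  have hFt : ∀ t, Tendsto (fun n => F n t) atTop (𝓝 t) := by
    intro t
    have h1 : Tendsto (fun n => t * Real.sinc (t / M n)) atTop (𝓝 (t * Real.sinc 0)) :=
      ((Real.continuous_sinc.tendsto 0).comp (hdiv t)).const_mul t
    rw [Real.sinc_zero, mul_one] at h1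
    refine h1.congr fun n => ?_
    by_cases ht : t = 0
    · simp [ht, F]
    · rw [Real.sinc_of_ne_zero (div_ne_zero ht (hM n).ne')]
      have := (hM n).ne'
      simp only [F]
      field_simp
  have hFt' : ∀ t, Tendsto (fun n => deriv (F n) t) atTop (𝓝 1) := by
    intro t
    simp_rw [hd']
    have := (Real.continuous_cos.tendsto 0).comp (hdiv t)
    rwa [Real.cos_zero] at this
  have hd1 : ∀ n t, |deriv (F n) t| ≤ 1 := fun n t => by
    rw [hd']; exact Real.abs_cos_le_one _
  choose v hv hvf hvg using fun n =>
    exists_comp_mem_H10 hΩ hu (hF n) (by simp [F]) (hd1 n)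
  refine ⟨v, H1.tendsto_of_fn_of_grad ?_ ?_, fun n => ⟨hv n, ⟨M n, ?_⟩, ?_⟩⟩
  · refine L2.tendsto_of_dominated ((Lp.memLp u.fn).norm.const_mul 2) (fun n => ?_) ?_
    · filter_upwards [hvf n] with x hx
      rw [hx]
      have := hb n (u.fn x)
      have h2 := norm_sub_le (F n (u.fn x)) (u.fn x)
      simp only [Real.norm_eq_abs] at h2 ⊢
      linarith
    · filter_upwards [ae_all_iff.2 hvf] with x hx
      simp_rw [hx]
      exact hFt _
  · refine L2.tendsto_of_dominated ((Lp.memLp u.grad).norm.const_mul 2) (fun n => ?_) ?_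
    · filter_upwards [hvg n] with x hx
      rw [hx]
      have h2 := norm_sub_le (deriv (F n) (u.fn x) • u.grad x) (u.grad x)
      rw [norm_smul] at h2
      have := mul_le_mul_of_nonneg_right (hd1 n (u.fn x)) (norm_nonneg (u.grad x))
      simp only [Real.norm_eq_abs] at h2 ⊢
      linarith
    · filter_upwards [ae_all_iff.2 hvg] with x hx
      simp_rw [hx]
      simpa using (hFt' (u.fn x)).smul_const (u.grad x)
  · filter_upwards [hvf n] with x hx
    rw [hx, abs_mul, abs_of_pos (hM n)]
    exact mul_le_of_le_one_right (hM n).le (Real.abs_sin_le_one _)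
  · filter_upwards [hvf n] with x hx h0
    rw [hx, h0]
    simp [F]

end Truncation

/-! ### The direct method for Rayleigh quotients. -/

section Minimization

variable {d : ℕ} {Ω : Set (Euc d)}

/-- The form `∫ ∇u·∇v + ∫ (T u) v` on `H¹(Ω)`, where `T` is a bounded operator on `L²(Ω)`. -/
def energy (T : L2 Ω ℝ →L[ℝ] L2 Ω ℝ) (u v : H1 Ω) : ℝ := ⟪u.grad, v.grad⟫ + ⟪T u.fn, v.fn⟫

theorem energy_zero_self (u : H1 Ω) : energy 0 u u = ‖u.grad‖ ^ 2 := by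
  simp [energy, -inner_self_eq_norm_sq_to_K, real_inner_self_eq_norm_sq]

/-- The first-variation argument: a quadratic that is minimal at t = 0 has no linear term there. -/
theorem eq_zero_of_forall_quadratic_nonneg {B A : ℝ} (h : ∀ t : ℝ, 0 ≤ 2 * t * B + t ^ 2 * A) :
    B = 0 := by
  have hA : 0 ≤ A := by
    have h1 := h 1
    have h2 := h (-1)
    linarith
  -- Nearly the minimising t; the shift by 1 keeps the denominator positive when A = 0.
  have h1 := h (-B / (A + 1))
  have h2 : 2 * (-B / (A + 1)) * B + (-B / (A + 1)) ^ 2 * A = -(B ^ 2 * (A + 2)) / (A + 1) ^ 2 := by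
    have : A + 1 ≠ 0 := by positivity
    field_simp
    ring
  rw [h2, div_nonneg_iff] at h1
  have h3 : 0 < (A + 1) ^ 2 := by positivity
  rcases h1 with ⟨h1, -⟩ | ⟨-, h1⟩
  · nlinarith [sq_nonneg B, mul_nonneg (sq_nonneg B) hA]
  · linarith

/-- Minimizers of the Rayleigh quotient on a subspace satisfy the Euler–Lagrange equation. -/
theorem energy_eq_of_isMinimizer {T : L2 Ω ℝ →L[ℝ] L2 Ω ℝ} (hT : ∀ f g, ⟪T f, g⟫ = ⟪T g, f⟫)
    {K : Submodule ℝ (H1 Ω)} {μ : ℝ} (hmin : ∀ η ∈ K, μ * ‖η.fn‖ ^ 2 ≤ energy T η η)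
    {u : H1 Ω} (hu : u ∈ K) (heq : energy T u u = μ * ‖u.fn‖ ^ 2) {η : H1 Ω} (hη : η ∈ K) :
    energy T u η = μ * ⟪u.fn, η.fn⟫ := by
  rw [← sub_eq_zero]
  refine eq_zero_of_forall_quadratic_nonneg (A := energy T η η - μ * ‖η.fn‖ ^ 2) fun t => ?_
  have h := hmin (u + t • η) (K.add_mem hu (K.smul_mem t hη))
  simp only [energy, ← real_inner_self_eq_norm_sq, H1.fn_add, H1.fn_smul, H1.grad_add,
    H1.grad_smul, map_add, map_smul, inner_add_left, inner_add_right, real_inner_smul_left,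
    real_inner_smul_right] at h heq ⊢
  rw [hT η.fn u.fn, real_inner_comm u.grad η.grad, real_inner_comm u.fn η.fn] at h
  nlinarith

/-- The direct method: the Rayleigh quotient attains its minimum on `H¹₀`. -/
theorem exists_isMinimizer (hΩ : IsOpen Ω) (hb : Bornology.IsBounded Ω)
    {T : L2 Ω ℝ →L[ℝ] L2 Ω ℝ} (hT0 : ∀ f, 0 ≤ ⟪T f, f⟫) {v : H1 Ω} (hv : v ∈ H10 Ω)
    (hv0 : v.fn ≠ 0) :
    ∃ (μ : ℝ) (u : H1 Ω), u ∈ H10 Ω ∧ ‖u.fn‖ = 1 ∧ energy T u u = μ ∧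
      ∀ η ∈ H10 Ω, μ * ‖η.fn‖ ^ 2 ≤ energy T η η := by
  set S : Set ℝ := {q | ∃ w ∈ H10 Ω, ‖w.fn‖ = 1 ∧ energy T w w = q}
  have hscale : ∀ η ∈ H10 Ω, η.fn ≠ 0 → energy T η η / ‖η.fn‖ ^ 2 ∈ S := by
    intro η hη h0
    refine ⟨‖η.fn‖⁻¹ • η, (H10Submodule Ω).smul_mem _ hη, ?_, ?_⟩
    · rw [H1.fn_smul, norm_smul, norm_inv, norm_norm, inv_mul_cancel₀ (norm_ne_zero_iff.2 h0)]
    · simp only [energy, H1.fn_smul, H1.grad_smul, map_smul, real_inner_smul_left,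
        real_inner_smul_right]
      rw [div_eq_inv_mul, ← inv_pow]
      ring
  have hnonneg : ∀ w : H1 Ω, ‖w.grad‖ ^ 2 ≤ energy T w w := fun w => by
    rw [energy, real_inner_self_eq_norm_sq]
    linarith [hT0 w.fn]
  have hbdd : BddBelow S := ⟨0, by
    rintro _ ⟨w, -, -, rfl⟩
    exact (sq_nonneg _).trans (hnonneg w)⟩
  have hne : S.Nonempty := ⟨_, hscale v hv hv0⟩
  obtain ⟨q, -, hqt, hqS⟩ := exists_seq_tendsto_sInf hne hbdd
  choose w hw hw1 hwq using hqS
  obtain ⟨Q, hQ⟩ := hqt.bddAbove_range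
  have hC : ∀ k, ‖w k‖ ≤ Real.sqrt (1 + Q) := by
    intro k
    refine Real.le_sqrt_of_sq_le ?_
    rw [H1.norm_sq, hw1]
    have := hnonneg (w k)
    have := hQ ⟨k, rfl⟩
    have := hwq k
    linarith
  obtain ⟨u, s, hs, hu, hweak, hstrong⟩ := exists_subseq_tendsto hΩ hb hw hC
  have hu1 : ‖u.fn‖ = 1 :=
    tendsto_nhds_unique hstrong.norm (by simp_rw [hw1]; exact tendsto_const_nhds)
  have hTlim : Tendsto (fun k => ⟪T (w (s k)).fn, (w (s k)).fn⟫) atTop (𝓝 ⟪T u.fn, u.fn⟫) :=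
    ((T.continuous.tendsto _).comp hstrong).inner hstrong
  -- Weak lower semicontinuity by hand: expand ‖w_k - u‖² ≥ 0, using weak convergence in the cross
  -- term and strong L² convergence in the operator term.
  have hle : energy T u u ≤ sInf S := by
    have h1 : Tendsto (fun k => 1 + q (s k) - ⟪T (w (s k)).fn, (w (s k)).fn⟫ -
        2 * ⟪w (s k), u⟫ + ‖u‖ ^ 2) atTop
        (𝓝 (1 + sInf S - ⟪T u.fn, u.fn⟫ - 2 * ⟪u, u⟫ + ‖u‖ ^ 2)) :=
      ((((hqt.comp hs.tendsto_atTop).const_add 1).sub hTlim).sub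
        ((hweak u).const_mul 2)).add_const _
    have h2 := ge_of_tendsto' h1 (b := 0) fun k => by
      have h3 : 1 + q (s k) - ⟪T (w (s k)).fn, (w (s k)).fn⟫ = ‖w (s k)‖ ^ 2 := by
        rw [H1.norm_sq, hw1, ← hwq, energy, real_inner_self_eq_norm_sq]
        ring
      rw [h3, ← norm_sub_sq_real]
      exact sq_nonneg _
    rw [real_inner_self_eq_norm_sq, H1.norm_sq, hu1] at h2
    rw [energy, real_inner_self_eq_norm_sq]
    linarith
  refine ⟨_, u, hu, hu1, rfl, fun η hη => ?_⟩
  by_cases h0 : η.fn = 0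
  · rw [h0, norm_zero, zero_pow two_ne_zero, mul_zero]
    exact (sq_nonneg _).trans (hnonneg η)
  · have h1 := hle.trans (csInf_le hbdd (hscale η hη h0))
    rwa [le_div_iff₀ (by have := norm_pos_iff.2 h0; positivity)] at h1

end Minimization

/-! ### Variational bound for the first eigenvalue. -/

section FirstEigenvalue

variable {d : ℕ} {Ω : Set (Euc d)}

/-- Multiplication by a bounded function as an operator on `L²(Ω)`. -/
def mulOp {c : Euc d → ℝ} (hc : MemLp c ⊤ (volume.restrict Ω)) : L2 Ω ℝ →L[ℝ] L2 Ω ℝ :=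
  (ContinuousLinearMap.mul ℝ ℝ).holderL (volume.restrict Ω) ⊤ 2 2 hc.toLp

theorem mulOp_ae {c : Euc d → ℝ} (hc : MemLp c ⊤ (volume.restrict Ω)) (f : L2 Ω ℝ) :
    mulOp hc f =ᵐ[volume.restrict Ω] fun x => c x * f x := by
  have := (ContinuousLinearMap.mul ℝ ℝ).coeFn_holder (r := 2) hc.toLp f
  filter_upwards [this, hc.coeFn_toLp] with x h1 h2
  rw [← h2]
  exact h1

theorem inner_mulOp {c : Euc d → ℝ} (hc : MemLp c ⊤ (volume.restrict Ω)) (f g : L2 Ω ℝ) :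
    ⟪mulOp hc f, g⟫ = ∫ x in Ω, c x * (f x * g x) := by
  rw [L2.inner_eq_integral_mul]
  refine integral_congr_ae ?_
  filter_upwards [mulOp_ae hc f] with x hx
  rw [hx, mul_assoc]

theorem inner_mulOp_self {c : Euc d → ℝ} (hc : MemLp c ⊤ (volume.restrict Ω)) (f : L2 Ω ℝ) :
    ⟪mulOp hc f, f⟫ = ∫ x in Ω, c x * f x ^ 2 := by
  simp_rw [inner_mulOp, sq]

theorem inner_mulOp_comm {c : Euc d → ℝ} (hc : MemLp c ⊤ (volume.restrict Ω)) (f g : L2 Ω ℝ) :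
    ⟪mulOp hc f, g⟫ = ⟪mulOp hc g, f⟫ := by
  simp_rw [inner_mulOp, mul_comm]

theorem inner_mulOp_nonneg {c : Euc d → ℝ} (hc : MemLp c ⊤ (volume.restrict Ω))
    (h0 : ∀ᵐ x ∂(volume.restrict Ω), 0 ≤ c x) (f : L2 Ω ℝ) : 0 ≤ ⟪mulOp hc f, f⟫ := by
  rw [inner_mulOp]
  refine integral_nonneg_of_ae ?_
  filter_upwards [h0] with x hx
  exact mul_nonneg hx (mul_self_nonneg _)

theorem integrable_coeff_mul_sq {c : Euc d → ℝ} (hc : MemLp c ⊤ (volume.restrict Ω))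
    (f : L2 Ω ℝ) : Integrable (fun x => c x * f x ^ 2) (volume.restrict Ω) := by
  refine (L2.integrable_mul (mulOp hc f) f).congr ?_
  filter_upwards [mulOp_ae hc f] with x hx
  rw [hx]
  ring

/-- A bounded coefficient acts as a bounded operator on L², so the phase-field problem and the limit
problem are both instances of `energy`, with operator `mulOp` and 0 respectively. -/
theorem isEigenfunction_iff {β : ℝ → ℝ} {φ : Euc d → ℝ}
    (hc : MemLp (fun x => β (φ x)) ⊤ (volume.restrict Ω)) {lam : ℝ} {w : H1 Ω} :
    IsEigenfunction Ω β φ lam w ↔ w ∈ H10 Ω ∧ w ≠ 0 ∧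
      ∀ η ∈ H10 Ω, energy (mulOp hc) w η = lam * ⟪w.fn, η.fn⟫ := by
  simp only [IsEigenfunction, energy, inner_mulOp]
  simp only [L2.inner_eq_integral_inner, L2.inner_eq_integral_mul]

theorem isLimitEigenfunction_iff {φ : Euc d → ℝ} {lam : ℝ} {w : H1 Ω} :
    IsLimitEigenfunction Ω φ lam w ↔ w ∈ V Ω φ ∧ w ≠ 0 ∧
      ∀ η ∈ V Ω φ, energy 0 w η = lam * ⟪w.fn, η.fn⟫ := by
  simp only [IsLimitEigenfunction, energy, zero_apply, inner_zero_left, add_zero]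
  simp only [L2.inner_eq_integral_inner, L2.inner_eq_integral_mul]

theorem H1.norm_fn_pos (hΩ : IsOpen Ω) {u : H1 Ω} (hu : u ≠ 0) : 0 < ‖u.fn‖ :=
  norm_pos_iff.2 fun h => hu (H1.ext_fn hΩ h)

/-- The first eigenvalue is bounded by every Rayleigh quotient. -/
theorem firstEigenvalue_mul_norm_sq_le (hΩ : IsOpen Ω) (hb : Bornology.IsBounded Ω)
    {β : ℝ → ℝ} {φ : Euc d → ℝ} (hc : MemLp (fun x => β (φ x)) ⊤ (volume.restrict Ω))
    (h0 : ∀ᵐ x ∂(volume.restrict Ω), 0 ≤ β (φ x)) {η : H1 Ω} (hη : η ∈ H10 Ω) :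
    firstEigenvalue Ω β φ * ‖η.fn‖ ^ 2 ≤ energy (mulOp hc) η η := by
  have hE : ∀ w : H1 Ω, 0 ≤ energy (mulOp hc) w w := fun w =>
    add_nonneg real_inner_self_nonneg (inner_mulOp_nonneg hc h0 _)
  by_cases hη0 : η.fn = 0
  · rw [hη0, norm_zero, zero_pow two_ne_zero, mul_zero]
    exact hE η
  obtain ⟨μ, u, hu, hu1, hμ, hmin⟩ := exists_isMinimizer hΩ hb (inner_mulOp_nonneg hc h0) hη hη0
  have heig : IsEigenfunction Ω β φ μ u := by
    refine (isEigenfunction_iff hc).2 ⟨hu, ?_, fun θ hθ => ?_⟩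
    · rintro rfl
      simp [show (0 : H1 Ω).fn = 0 from rfl] at hu1
    · exact energy_eq_of_isMinimizer (K := H10Submodule Ω) (inner_mulOp_comm hc) hmin hu
        (by rw [hu1, hμ]; ring) hθ
  -- Without a lower bound the real `sInf` would carry no information; testing an eigenfunction with
  -- itself gives 0.
  have hbdd : BddBelow {lam | ∃ w : H1 Ω, IsEigenfunction Ω β φ lam w} := by
    refine ⟨0, ?_⟩
    rintro lam ⟨w, hw⟩
    obtain ⟨hw, hw0, h⟩ := (isEigenfunction_iff hc).1 hw
    have h1 := h w hw
    have h2 := H1.norm_fn_pos hΩ hw0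
    rw [real_inner_self_eq_norm_sq] at h1
    have h3 := hE w
    rw [h1] at h3
    exact nonneg_of_mul_nonneg_left h3 (by positivity)
  exact (mul_le_mul_of_nonneg_right (csInf_le hbdd ⟨u, heig⟩) (sq_nonneg _)).trans (hmin η hη)

end FirstEigenvalue

/-! ### Bounds and asymptotics of the coefficients. -/

section Coefficients

variable {d : ℕ} {Ω : Set (Euc d)} {b : ℝ → ℝ → ℝ} {b₀ : ℝ → ℝ≥0∞} {bbar : ℝ → ℝ}

/-- Continuity is known on [-1, 1] only, so g is first extended by its endpoint values; the
composition is unchanged almost everywhere. -/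
theorem aestronglyMeasurable_comp_of_continuousOn {α : Type*} [MeasurableSpace α] {μ : Measure α}
    {g : ℝ → ℝ} (hg : ContinuousOn g (Icc (-1) 1)) {ψ : α → ℝ} (hψ : AEStronglyMeasurable ψ μ)
    (hle : ∀ᵐ x ∂μ, |ψ x| ≤ 1) : AEStronglyMeasurable (fun x => g (ψ x)) μ := by
  have h11 : (-1 : ℝ) ≤ 1 := by norm_num
  have hc : Continuous (IccExtend h11 ((Icc (-1) 1).domRestrict g)) :=
    (continuousOn_iff_continuous_domRestrict.1 hg).Icc_extend'
  refine (hc.comp_aestronglyMeasurable hψ).congr ?_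
  filter_upwards [hle] with x hx
  rw [IccExtend_of_mem _ _ (abs_le.1 hx)]
  rfl

theorem IsCoefficientFamily.mem_Icc (hb : IsCoefficientFamily b b₀ bbar) {ε : ℝ} (hε : 0 < ε)
    {t : ℝ} (ht : t ∈ Icc (-1 : ℝ) 1) : b ε t ∈ Icc 0 (bbar ε) := by
  rw [← hb.image ε hε]
  exact mem_image_of_mem _ ht

/-- Monotonicity places the attained maximum at the left endpoint; this is the penalty that blows up
on {φ = -1}. -/
theorem IsCoefficientFamily.apply_neg_one (hb : IsCoefficientFamily b b₀ bbar) {ε : ℝ}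
    (hε : 0 < ε) : b ε (-1) = bbar ε := by
  have h1 : (-1 : ℝ) ∈ Icc (-1 : ℝ) 1 := by simp
  have h2 := hb.mem_Icc hε h1
  refine le_antisymm h2.2 ?_
  obtain ⟨t, ht, hbt⟩ : bbar ε ∈ b ε '' Icc (-1) 1 := by
    rw [hb.image ε hε]
    exact right_mem_Icc.2 (h2.1.trans h2.2)
  rw [← hbt]
  exact hb.antitone ε hε h1 ht ht.1

theorem IsCoefficientFamily.zero_apply_one (hb : IsCoefficientFamily b b₀ bbar) : b₀ 1 = 0 := by
  obtain ⟨t, ht, hbt⟩ : (0 : ℝ≥0∞) ∈ b₀ '' Icc (-1) 1 := by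
    rw [hb.image_zero]
    trivial
  have := hb.antitone_zero ht (by simp : (1 : ℝ) ∈ Icc (-1 : ℝ) 1) ht.2
  rw [hbt] at this
  exact le_antisymm this zero_le

theorem IsCoefficientFamily.memLp (hb : IsCoefficientFamily b b₀ bbar) {ε : ℝ} (hε : 0 < ε)
    {ψ : Euc d → ℝ} (hψ : AEStronglyMeasurable ψ (volume.restrict Ω))
    (hle : ∀ᵐ x ∂(volume.restrict Ω), |ψ x| ≤ 1) :
    MemLp (fun x => b ε (ψ x)) ⊤ (volume.restrict Ω) := by
  refine memLp_top_of_bound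
    (aestronglyMeasurable_comp_of_continuousOn (hb.continuous ε hε) hψ hle) (bbar ε) ?_
  filter_upwards [hle] with x hx
  have := hb.mem_Icc hε (abs_le.1 hx)
  rw [Real.norm_of_nonneg this.1]
  exact this.2

theorem IsCoefficientFamily.ae_nonneg (hb : IsCoefficientFamily b b₀ bbar) {ε : ℝ} (hε : 0 < ε)
    {ψ : Euc d → ℝ} (hle : ∀ᵐ x ∂(volume.restrict Ω), |ψ x| ≤ 1) :
    ∀ᵐ x ∂(volume.restrict Ω), 0 ≤ b ε (ψ x) := by
  filter_upwards [hle] with x hx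
  exact (hb.mem_Icc hε (abs_le.1 hx)).1

/-- The coefficients vanish asymptotically along sequences converging to `1`. -/
theorem IsCoefficientFamily.tendsto_zero_of_tendsto_one (hb : IsCoefficientFamily b b₀ bbar)
    {ε : ℕ → ℝ} (hε : ∀ k, 0 < ε k) {t : ℕ → ℝ} (ht : ∀ k, t k ∈ Icc (-1 : ℝ) 1)
    (ht1 : Tendsto t atTop (𝓝 1)) : Tendsto (fun k => b (ε k) (t k)) atTop (𝓝 0) := by
  have h1 : Tendsto (fun k => b₀ (t k)) atTop (𝓝 0) := by
    have := hb.continuous_zero 1 (by simp)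
    rw [ContinuousWithinAt, hb.zero_apply_one] at this
    exact this.comp (tendsto_nhdsWithin_iff.2 ⟨ht1, Eventually.of_forall ht⟩)
  -- The bound by b₀ removes the dependence on ε, leaving only the continuity of b₀ at 1.
  have h2 : Tendsto (fun k => ENNReal.ofReal (b (ε k) (t k))) atTop (𝓝 0) :=
    tendsto_of_tendsto_of_tendsto_of_le_of_le tendsto_const_nhds h1 (fun _ => zero_le)
      fun k => hb.le_zero _ (hε k) _ (ht k)
  have h3 := (ENNReal.tendsto_toReal ENNReal.zero_ne_top).comp h2
  simp only [ENNReal.toReal_zero] at h3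
  exact h3.congr fun k => ENNReal.toReal_ofReal (hb.mem_Icc (hε k) (ht k)).1

/-- The product of o(ε^{-2/3}) and O(ε) is o(ε^{1/3}). -/
theorem IsCoefficientFamily.tendsto_bbar_mul (hb : IsCoefficientFamily b b₀ bbar) {ε : ℕ → ℝ}
    (hεpos : ∀ k, 0 < ε k) (hε : Tendsto ε atTop (𝓝 0)) {a : ℕ → ℝ} (ha : a =O[atTop] ε) :
    Tendsto (fun k => bbar (ε k) * a k) atTop (𝓝 0) := by
  have hε' : Tendsto ε atTop (𝓝[>] 0) :=
    tendsto_nhdsWithin_iff.2 ⟨hε, Eventually.of_forall hεpos⟩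
  have h1 := (hb.bbar_isLittleO.comp_tendsto hε').mul_isBigO ha
  have h2 : Tendsto (fun k => ε k ^ (1 / 3 : ℝ)) atTop (𝓝 0) := by
    have := hε.rpow_const (p := 1 / 3) (Or.inr (by norm_num))
    rwa [Real.zero_rpow (by norm_num)] at this
  refine h1.isBigO.trans_tendsto (h2.congr fun k => ?_)
  have := Real.rpow_add_one (hεpos k).ne' (-(2 / 3))
  rw [Function.comp_apply, ← this]
  norm_num

end Coefficients

/-! ### Passage to the limit problem. -/

section Limit

variable {d : ℕ} {Ω : Set (Euc d)} {b : ℝ → ℝ → ℝ} {b₀ : ℝ → ℝ≥0∞} {bbar : ℝ → ℝ}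
  {φ : Euc d → ℝ}

/-- `V^φ` as a subspace. -/
def VSubmodule (Ω : Set (Euc d)) (φ : Euc d → ℝ) : Submodule ℝ (H1 Ω) where
  carrier := V Ω φ
  zero_mem' := ⟨(H10Submodule Ω).zero_mem, by
    filter_upwards [Lp.coeFn_zero ℝ 2 (volume.restrict Ω)] with x hx _ using hx⟩
  add_mem' := by
    rintro u v ⟨hu, hu0⟩ ⟨hv, hv0⟩
    refine ⟨(H10Submodule Ω).add_mem hu hv, ?_⟩
    filter_upwards [hu0, hv0, Lp.coeFn_add u.fn v.fn] with x h1 h2 h3 hx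
    rw [H1.fn_add, h3, Pi.add_apply, h1 hx, h2 hx, add_zero]
  smul_mem' := by
    rintro c u ⟨hu, hu0⟩
    refine ⟨(H10Submodule Ω).smul_mem c hu, ?_⟩
    filter_upwards [hu0, Lp.coeFn_smul c u.fn] with x h1 h3 hx
    rw [H1.fn_smul, h3, Pi.smul_apply, h1 hx, smul_zero]

/-- A nonzero bounded element of `V^φ`, supported in a ball where `φ = 1`. -/
theorem exists_bounded_mem_V {z : Euc d} {r : ℝ} (hr : 0 < r) (hΩ : IsOpen Ω)
    (hz : Metric.ball z r ⊆ Ω) (hφ : ∀ᵐ x ∂(volume.restrict (Metric.ball z r)), φ x = 1) :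
    ∃ v ∈ V Ω φ, v.fn ≠ 0 ∧ ∃ C, ∀ᵐ x ∂(volume.restrict Ω), |v.fn x| ≤ C := by
  let f : ContDiffBump z := ⟨r / 4, r / 2, by positivity, by linarith⟩
  have hf : IsTest Ω f := by
    refine ⟨f.contDiff, f.hasCompactSupport, ?_⟩
    rw [f.tsupport_eq]
    exact (Metric.closedBall_subset_ball (by simp [f, hr])).trans hz
  refine ⟨hf.toH1, ⟨hf.toH1_mem, ?_⟩, fun h0 => ?_, 1, ?_⟩
  · have h1 : ∀ᵐ x ∂(volume.restrict Ω), x ∈ Metric.ball z r → φ x = 1 :=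
      ae_restrict_of_ae ((ae_restrict_iff' measurableSet_ball).1 hφ)
    filter_upwards [h1, hf.toH1_fn] with x h1 h2 hx
    rw [h2]
    by_contra hne
    have hxs : x ∈ Metric.ball z (r / 2) := by
      rw [← show Function.support f = Metric.ball z (r / 2) from f.support_eq]
      exact hne
    have hxb := Metric.ball_subset_ball (by linarith : r / 2 ≤ r) hxs
    exact hx ⟨hz hxb, h1 hxb⟩
  · have h1 : f =ᵐ[volume.restrict Ω] fun _ => (0 : ℝ) := by
      have := hf.toH1_fn
      rw [h0] at this
      exact this.symm.trans (Lp.coeFn_zero _ _ _)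
    -- Continuity upgrades a.e. vanishing on the open set to vanishing at the centre, where the bump
    -- equals 1.
    have h2 := Measure.eqOn_open_of_ae_eq h1 hΩ f.continuous.continuousOn continuousOn_const
      (hz (Metric.mem_ball_self hr))
    have h3 : f z = 1 := f.one_of_mem_closedBall (Metric.mem_closedBall_self f.rIn_pos.le)
    rw [h3] at h2
    exact one_ne_zero h2
  · filter_upwards [hf.toH1_fn] with x hx
    rw [hx, abs_of_nonneg f.nonneg]
    exact f.le_one

/-- The coefficient term vanishes in the limit on bounded elements of `V^φ`. -/
theorem tendsto_integral_coeff_mul_sq (hΩ : MeasurableSet Ω) (hb : IsCoefficientFamily b b₀ bbar)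
    (hφ : IntegrableOn φ Ω) {ε : ℕ → ℝ} (hεpos : ∀ k, 0 < ε k) (hε : Tendsto ε atTop (𝓝 0))
    {ψ : ℕ → Euc d → ℝ} (hψ : ∀ k, IntegrableOn (ψ k) Ω)
    (hle : ∀ k, ∀ᵐ x ∂(volume.restrict Ω), |ψ k x| ≤ 1)
    (hae : ∀ᵐ x ∂(volume.restrict Ω), Tendsto (fun k => ψ k x) atTop (𝓝 (φ x)))
    (hrate : (fun k => ∫ x in posSet Ω φ ∩ {x | ψ k x < 0}, |ψ k x - φ x|) =O[atTop] ε)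
    {η : H1 Ω} (hη : η ∈ V Ω φ) {C : ℝ} (hC : ∀ᵐ x ∂(volume.restrict Ω), |η.fn x| ≤ C) :
    Tendsto (fun k => ∫ x in Ω, b (ε k) (ψ k x) * η.fn x ^ 2) atTop (𝓝 0) := by
  set A : ℕ → Set (Euc d) := fun k => posSet Ω φ ∩ {x | ψ k x < 0}
  have hA : ∀ k, NullMeasurableSet (A k) (volume.restrict Ω) := fun k =>
    (hΩ.nullMeasurableSet.inter
      (hφ.1.aemeasurable.nullMeasurableSet_preimage (measurableSet_singleton 1))).inter
      ((hψ k).1.aemeasurable.nullMeasurableSet_preimage measurableSet_Iio)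
  have hmax : ∀ k, ∀ᵐ x ∂(volume.restrict Ω), |max (ψ k x) 0| ≤ 1 := fun k => by
    filter_upwards [hle k] with x hx
    rw [abs_of_nonneg (le_max_right _ _)]
    exact max_le (abs_le.1 hx).2 zero_le_one
  have hcm : ∀ k, AEStronglyMeasurable (fun x => max (ψ k x) 0) (volume.restrict Ω) := fun k =>
    (hψ k).1.sup aestronglyMeasurable_const
  have hmem := fun k => hb.memLp (hεpos k) (hcm k) (hmax k)
  have hI : ∀ k, Integrable ((A k).indicator fun x => |ψ k x - φ x|) (volume.restrict Ω) :=
    fun k => (((hψ k).sub hφ).abs).indicator₀ (hA k)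
  have hIeq : ∀ k, ∫ x in Ω, (A k).indicator (fun x => |ψ k x - φ x|) x =
      ∫ x in A k, |ψ k x - φ x| := fun k => by
    rw [integral_indicator₀ (hA k), Measure.restrict_restrict₀ (hA k),
      inter_eq_left.2 fun x hx => hx.1.1]
  -- Clipping the phase field at 0 keeps its coefficient below the finite number b₀(0), which
  -- supplies an integrable majorant.
  have h1 : Tendsto (fun k => ∫ x in Ω, b (ε k) (max (ψ k x) 0) * η.fn x ^ 2) atTop (𝓝 0) := by
    suffices h : Tendsto (fun k => ∫ x in Ω, b (ε k) (max (ψ k x) 0) * η.fn x ^ 2) atTop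
        (𝓝 (∫ _ in Ω, (0 : ℝ))) by rwa [integral_zero] at h
    refine tendsto_integral_of_dominated_convergence (fun x => (b₀ 0).toReal * η.fn x ^ 2)
      (fun k => (integrable_coeff_mul_sq (hmem k) _).1) ((L2.integrable_sq _).const_mul _)
      (fun k => ?_) ?_
    · filter_upwards [hmax k] with x hx
      have h0 : (0 : ℝ) ∈ Icc (-1 : ℝ) 1 := by simp
      have h2 := hb.mem_Icc (hεpos k) (abs_le.1 hx)
      rw [Real.norm_of_nonneg (mul_nonneg h2.1 (sq_nonneg _))]
      gcongr
      refine (hb.antitone _ (hεpos k) h0 (abs_le.1 hx) (le_max_right _ _)).trans ?_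
      rw [← ENNReal.ofReal_le_iff_le_toReal hb.finite_zero.ne]
      exact hb.le_zero _ (hεpos k) _ h0
    · filter_upwards [hη.2, hae, ae_all_iff.2 hmax] with x h2 h3 h4
      by_cases hx : x ∈ posSet Ω φ
      · rw [hx.2] at h3
        have h5 : Tendsto (fun k => max (ψ k x) 0) atTop (𝓝 1) := by
          simpa using h3.max (tendsto_const_nhds (x := (0 : ℝ)))
        simpa using (hb.tendsto_zero_of_tendsto_one hεpos (fun k => abs_le.1 (h4 k)) h5).mul_const
          (η.fn x ^ 2)
      · simp [h2 hx]
  have h2 : Tendsto (fun k => (∫ x in Ω, b (ε k) (max (ψ k x) 0) * η.fn x ^ 2) +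
      C ^ 2 * (bbar (ε k) * ∫ x in A k, |ψ k x - φ x|)) atTop (𝓝 0) := by
    simpa using h1.add ((hb.tendsto_bbar_mul hεpos hε hrate).const_mul (C ^ 2))
  refine tendsto_of_tendsto_of_tendsto_of_le_of_le tendsto_const_nhds h2 (fun k => ?_) fun k => ?_
  · refine integral_nonneg_of_ae ?_
    filter_upwards [hle k] with x hx
    exact mul_nonneg (hb.mem_Icc (hεpos k) (abs_le.1 hx)).1 (sq_nonneg _)
  · simp only
    rw [← hIeq, ← integral_const_mul, ← integral_const_mul,
      ← integral_add (integrable_coeff_mul_sq (hmem k) _) (((hI k).const_mul _).const_mul _)]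
    refine integral_mono_ae (integrable_coeff_mul_sq (hb.memLp (hεpos k) (hψ k).1 (hle k)) _)
      ((integrable_coeff_mul_sq (hmem k) _).add (((hI k).const_mul _).const_mul _)) ?_
    filter_upwards [hle k, hmax k, hη.2, hC] with x h3 h4 h5 h6
    have h7 := hb.mem_Icc (hεpos k) (abs_le.1 h3)
    have h8 := hb.mem_Icc (hεpos k) (abs_le.1 h4)
    have h9 : 0 ≤ bbar (ε k) := h7.1.trans h7.2
    have h10 : 0 ≤ C ^ 2 * (bbar (ε k) * (A k).indicator (fun x => |ψ k x - φ x|) x) :=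
      mul_nonneg (sq_nonneg _) (mul_nonneg h9 (indicator_nonneg (fun _ _ => abs_nonneg _) _))
    have h11 : 0 ≤ b (ε k) (max (ψ k x) 0) * η.fn x ^ 2 := mul_nonneg h8.1 (sq_nonneg _)
    by_cases hx : x ∈ posSet Ω φ
    · by_cases hneg : ψ k x < 0
      · rw [indicator_of_mem (show x ∈ A k from ⟨hx, hneg⟩)] at h10 ⊢
        -- Chebyshev's idea: on the bad set the phase field is negative while φ = 1, so the L¹
        -- distance controls the measure of that set.
        have h12 : 1 ≤ |ψ k x - φ x| := by
          rw [hx.2, abs_of_neg (by linarith)]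
          linarith
        have h13 : η.fn x ^ 2 ≤ C ^ 2 := sq_le_sq' (abs_le.1 h6).1 (abs_le.1 h6).2
        calc b (ε k) (ψ k x) * η.fn x ^ 2 ≤ bbar (ε k) * C ^ 2 :=
              mul_le_mul h7.2 h13 (sq_nonneg _) h9
          _ = C ^ 2 * (bbar (ε k) * 1) := by ring
          _ ≤ C ^ 2 * (bbar (ε k) * |ψ k x - φ x|) := by gcongr
          _ ≤ _ := le_add_of_nonneg_left h11
      · rw [max_eq_left (not_lt.1 hneg)]
        exact le_add_of_nonneg_right h10
    · rw [h5 hx] at h11 ⊢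
      simp only [ne_eq, OfNat.ofNat_ne_zero, not_false_eq_true, zero_pow, mul_zero] at h11 ⊢
      linarith

/-- A uniform bound on the coefficient term forces the limit to vanish where `φ = -1`. -/
theorem mem_V_of_tendsto (hb : IsCoefficientFamily b b₀ bbar)
    (hφ : IntegrableOn φ Ω) (hφ1 : ∀ᵐ x ∂(volume.restrict Ω), φ x = 1 ∨ φ x = -1)
    (hΩ : MeasurableSet Ω) {ε : ℕ → ℝ} (hεpos : ∀ k, 0 < ε k) (hε : Tendsto ε atTop (𝓝 0))
    {ψ : ℕ → Euc d → ℝ} (hψ : ∀ k, IntegrableOn (ψ k) Ω)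
    (hle : ∀ k, ∀ᵐ x ∂(volume.restrict Ω), |ψ k x| ≤ 1)
    (hae : ∀ᵐ x ∂(volume.restrict Ω), Tendsto (fun k => ψ k x) atTop (𝓝 (φ x)))
    {w : ℕ → H1 Ω} {u : H1 Ω} (hu : u ∈ H10 Ω)
    (hwu : Tendsto (fun k => (w k).fn) atTop (𝓝 u.fn)) {L : ℝ}
    (hL : ∀ k, ∫ x in Ω, b (ε k) (ψ k x) * (w k).fn x ^ 2 ≤ L) : u ∈ V Ω φ := by
  have hφle : ∀ᵐ x ∂(volume.restrict Ω), |φ x| ≤ 1 := by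
    filter_upwards [hφ1] with x hx
    rcases hx with h | h <;> simp [h]
  -- This function is a.e. the indicator of {φ = -1}.
  have hχ : MemLp (fun x => (1 - φ x) / 2) ⊤ (volume.restrict Ω) := by
    refine memLp_top_of_bound (by
      have := hφ.1
      fun_prop) 1 ?_
    filter_upwards [hφ1] with x hx
    rcases hx with h | h <;> norm_num [h]
  have hχ0 : ∀ᵐ x ∂(volume.restrict Ω), 0 ≤ (1 - φ x) / 2 := by
    filter_upwards [hφle] with x hx
    linarith [(abs_le.1 hx).2]
  -- Freezing δ replaces the unbounded family by the single bounded function b_δ, which lies below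
  -- b_{ε_k} once ε_k ≤ δ.
  have hbound : ∀ δ > 0, bbar δ * ∫ x in Ω, (1 - φ x) / 2 * u.fn x ^ 2 ≤ L := by
    intro δ hδ
    have hm := fun k => hb.memLp hδ (hψ k).1 (hle k)
    have hm0 := hb.memLp hδ hφ.1 hφle
    have ht : Tendsto (fun k => mulOp (hm k) u.fn) atTop (𝓝 (mulOp hm0 u.fn)) := by
      refine L2.tendsto_of_dominated ((Lp.memLp u.fn).norm.const_mul (bbar δ)) (fun k => ?_) ?_
      · filter_upwards [mulOp_ae (hm k) u.fn, mulOp_ae hm0 u.fn, hle k, hφle] with x h1 h2 h3 h4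
        rw [h1, h2, ← sub_mul, norm_mul]
        gcongr
        have h5 := hb.mem_Icc hδ (abs_le.1 h3)
        have h6 := hb.mem_Icc hδ (abs_le.1 h4)
        rw [Real.norm_eq_abs, abs_le]
        constructor <;> linarith [h5.1, h5.2, h6.1, h6.2]
      · filter_upwards [ae_all_iff.2 fun k => mulOp_ae (hm k) u.fn, mulOp_ae hm0 u.fn,
          ae_all_iff.2 hle, hφle, hae] with x h1 h2 h3 h4 h5
        simp_rw [h1]
        rw [h2]
        exact ((hb.continuous δ hδ _ (abs_le.1 h4)).tendsto.comp (tendsto_nhdsWithin_iff.2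
          ⟨h5, Eventually.of_forall fun k => abs_le.1 (h3 k)⟩)).mul_const _
    -- Nonnegativity of the form at w_k - u bounds its value at w_k below by this expression, which
    -- is affine in w_k and passes to the limit.
    have h1 : Tendsto (fun k => 2 * ⟪mulOp (hm k) u.fn, (w k).fn⟫ - ⟪mulOp (hm k) u.fn, u.fn⟫)
        atTop (𝓝 (2 * ⟪mulOp hm0 u.fn, u.fn⟫ - ⟪mulOp hm0 u.fn, u.fn⟫)) :=
      ((ht.inner hwu).const_mul 2).sub (ht.inner tendsto_const_nhds)
    have h2 : ⟪mulOp hm0 u.fn, u.fn⟫ ≤ L := by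
      have h3 := le_of_tendsto h1 (b := L) (by
        filter_upwards [hε.eventually_le_const hδ] with k hk
        have h4 := inner_mulOp_nonneg (hm k) (hb.ae_nonneg hδ (hle k)) ((w k).fn - u.fn)
        simp only [map_sub, inner_sub_left, inner_sub_right] at h4
        rw [inner_mulOp_comm (hm k) (w k).fn u.fn] at h4
        have h5 : ⟪mulOp (hm k) (w k).fn, (w k).fn⟫ ≤ L := by
          refine le_trans ?_ (hL k)
          rw [inner_mulOp_self]
          refine integral_mono_ae (integrable_coeff_mul_sq (hm k) _)
            (integrable_coeff_mul_sq (hb.memLp (hεpos k) (hψ k).1 (hle k)) _) ?_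
          filter_upwards [hle k] with x hx
          have := hb.mono _ _ (hεpos k) hk _ (abs_le.1 hx)
          gcongr
        linarith)
      linarith
    refine le_trans ?_ h2
    rw [inner_mulOp_self, ← integral_const_mul]
    refine integral_mono_ae ((integrable_coeff_mul_sq hχ _).const_mul _)
      (integrable_coeff_mul_sq hm0 _) ?_
    filter_upwards [hφ1] with x hx
    rcases hx with h | h
    · have := mul_nonneg (hb.mem_Icc hδ (by simp : (1 : ℝ) ∈ Icc (-1 : ℝ) 1)).1
        (sq_nonneg (u.fn x))
      simpa [h] using this
    · rw [h, hb.apply_neg_one hδ]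
      norm_num
  have hJ : ∫ x in Ω, (1 - φ x) / 2 * u.fn x ^ 2 = 0 := by
    have hJ0 : 0 ≤ ∫ x in Ω, (1 - φ x) / 2 * u.fn x ^ 2 := by
      refine integral_nonneg_of_ae ?_
      filter_upwards [hχ0] with x hx
      exact mul_nonneg hx (sq_nonneg _)
    by_contra hne
    have hpos := lt_of_le_of_ne hJ0 (Ne.symm hne)
    -- As δ → 0 the maximum of b_δ exceeds L divided by the supposedly positive integral, a
    -- contradiction.
    obtain ⟨δ, hδ, hδ0⟩ := ((hb.bbar_tendsto.eventually_gt_atTop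
      (L / ∫ x in Ω, (1 - φ x) / 2 * u.fn x ^ 2)).and self_mem_nhdsWithin).exists
    rw [div_lt_iff₀ hpos] at hδ
    exact absurd (hbound δ hδ0) (not_le.2 hδ)
  refine ⟨hu, ?_⟩
  rw [integral_eq_zero_iff_of_nonneg_ae (by
    filter_upwards [hχ0] with x hx
    exact mul_nonneg hx (sq_nonneg _)) (integrable_coeff_mul_sq hχ _)] at hJ
  filter_upwards [hJ, hφ1, ae_restrict_mem hΩ] with x h1 h2 h3 h4
  rcases h2 with h | h
  · exact absurd ⟨h3, h⟩ h4
  · simpa [h] using h1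

/-- Minimizers of the Rayleigh quotient on `V^φ` are first eigenfunctions. -/
theorem isLeast_of_isMinimizer (hΩ : IsOpen Ω) {u : H1 Ω} (hu : u ∈ V Ω φ) (hu1 : ‖u.fn‖ = 1)
    {lam : ℝ} (hlam : ‖u.grad‖ ^ 2 = lam)
    (hmin : ∀ η ∈ V Ω φ, lam * ‖η.fn‖ ^ 2 ≤ ‖η.grad‖ ^ 2) :
    IsLeast {lam | ∃ v : H1 Ω, IsLimitEigenfunction Ω φ lam v} lam ∧
      IsLimitEigenfunction Ω φ lam u := by
  have heig : IsLimitEigenfunction Ω φ lam u := by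
    refine isLimitEigenfunction_iff.2 ⟨hu, ?_, fun η hη => ?_⟩
    · rintro rfl
      simp [show (0 : H1 Ω).fn = 0 from rfl] at hu1
    · refine energy_eq_of_isMinimizer (K := VSubmodule Ω φ) (fun f g => by simp)
        (fun η hη => ?_) hu ?_ hη
      · rw [energy_zero_self]
        exact hmin η hη
      · rw [energy_zero_self, hlam, hu1]
        ring
  refine ⟨⟨⟨u, heig⟩, ?_⟩, heig⟩
  rintro μ ⟨v, hv⟩
  obtain ⟨hv, hv0, h⟩ := isLimitEigenfunction_iff.1 hv
  have h1 := h v hv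
  rw [energy_zero_self, real_inner_self_eq_norm_sq] at h1
  have h2 := hmin v hv
  rw [h1] at h2
  have h3 := H1.norm_fn_pos hΩ hv0
  exact le_of_mul_le_mul_right h2 (by positivity)

/-- Eigenvalues whose limit exists are asymptotically below the Rayleigh quotients on `V^φ`. -/
theorem mul_norm_sq_le_of_tendsto (hΩ : IsOpen Ω) (hbd : Bornology.IsBounded Ω)
    (hb : IsCoefficientFamily b b₀ bbar)
    (hφ : IntegrableOn φ Ω) {ε : ℕ → ℝ} (hεpos : ∀ k, 0 < ε k) (hε : Tendsto ε atTop (𝓝 0))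
    {ψ : ℕ → Euc d → ℝ} (hψ : ∀ k, IntegrableOn (ψ k) Ω)
    (hle : ∀ k, ∀ᵐ x ∂(volume.restrict Ω), |ψ k x| ≤ 1)
    (hae : ∀ᵐ x ∂(volume.restrict Ω), Tendsto (fun k => ψ k x) atTop (𝓝 (φ x)))
    (hrate : (fun k => ∫ x in posSet Ω φ ∩ {x | ψ k x < 0}, |ψ k x - φ x|) =O[atTop] ε)
    {lam : ℝ} (hlam : Tendsto (fun k => firstEigenvalue Ω (b (ε k)) (ψ k)) atTop (𝓝 lam))
    {η : H1 Ω} (hη : η ∈ V Ω φ) : lam * ‖η.fn‖ ^ 2 ≤ ‖η.grad‖ ^ 2 := by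
  -- The coefficient estimate needs bounded competitors; truncation preserves zeros and so stays in
  -- V^φ.
  obtain ⟨v, hv, hvp⟩ := exists_bounded_tendsto hΩ hη.1
  have hvle : ∀ n, lam * ‖(v n).fn‖ ^ 2 ≤ ‖(v n).grad‖ ^ 2 := by
    intro n
    obtain ⟨hv0, ⟨C, hC⟩, hz⟩ := hvp n
    have hvV : v n ∈ V Ω φ := ⟨hv0, by
      filter_upwards [hη.2, hz] with x h1 h2 hx using h2 (h1 hx)⟩
    have h1 := tendsto_integral_coeff_mul_sq hΩ.measurableSet hb hφ hεpos hε hψ hle hae hrate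
      hvV hC
    have h2 := h1.const_add (‖(v n).grad‖ ^ 2)
    rw [add_zero] at h2
    refine le_of_tendsto_of_tendsto' (hlam.mul_const _) h2 fun k => ?_
    have h3 := firstEigenvalue_mul_norm_sq_le hΩ hbd (hb.memLp (hεpos k) (hψ k).1 (hle k))
      (hb.ae_nonneg (hεpos k) (hle k)) hv0
    rwa [energy, real_inner_self_eq_norm_sq, inner_mulOp_self] at h3
  exact le_of_tendsto_of_tendsto'
    ((((H1.continuous_fn.tendsto η).comp hv).norm.pow 2).const_mul lam)
    (((H1.continuous_grad.tendsto η).comp hv).norm.pow 2) hvle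

/-- The first eigenvalues are bounded if `φ = 1` on a ball. -/
theorem exists_firstEigenvalue_le (hΩ : IsOpen Ω) (hbd : Bornology.IsBounded Ω)
    (hb : IsCoefficientFamily b b₀ bbar)
    (hφ : IntegrableOn φ Ω) {ε : ℕ → ℝ} (hεpos : ∀ k, 0 < ε k) (hε : Tendsto ε atTop (𝓝 0))
    {ψ : ℕ → Euc d → ℝ} (hψ : ∀ k, IntegrableOn (ψ k) Ω)
    (hle : ∀ k, ∀ᵐ x ∂(volume.restrict Ω), |ψ k x| ≤ 1)
    (hae : ∀ᵐ x ∂(volume.restrict Ω), Tendsto (fun k => ψ k x) atTop (𝓝 (φ x)))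
    (hrate : (fun k => ∫ x in posSet Ω φ ∩ {x | ψ k x < 0}, |ψ k x - φ x|) =O[atTop] ε)
    (hball : ∃ (z : Euc d) (r : ℝ), 0 < r ∧ Metric.ball z r ⊆ Ω ∧
      ∀ᵐ x ∂(volume.restrict (Metric.ball z r)), φ x = 1) :
    ∃ L, ∀ k, firstEigenvalue Ω (b (ε k)) (ψ k) ≤ L := by
  obtain ⟨z, r, hr, hz, hzφ⟩ := hball
  obtain ⟨v, hv, hv0, C, hC⟩ := exists_bounded_mem_V hr hΩ hz hzφ
  obtain ⟨L, hL⟩ := (tendsto_integral_coeff_mul_sq hΩ.measurableSet hb hφ hεpos hε hψ hle hae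
    hrate hv hC).bddAbove_range
  refine ⟨(‖v.grad‖ ^ 2 + L) / ‖v.fn‖ ^ 2, fun k => ?_⟩
  have h1 := norm_pos_iff.2 hv0
  rw [le_div_iff₀ (by positivity)]
  have h3 := firstEigenvalue_mul_norm_sq_le hΩ hbd (hb.memLp (hεpos k) (hψ k).1 (hle k))
    (hb.ae_nonneg (hεpos k) (hle k)) hv.1
  rw [energy, real_inner_self_eq_norm_sq, inner_mulOp_self] at h3
  exact h3.trans (add_le_add_right (hL ⟨k, rfl⟩) _)

/-- First eigenfunctions converging weakly in `H¹` and strongly in `L²` converge strongly in `H¹`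
to a first eigenfunction of the limit problem. -/
theorem tendsto_of_weak_tendsto (hΩ : IsOpen Ω) (hbd : Bornology.IsBounded Ω)
    (hb : IsCoefficientFamily b b₀ bbar)
    (hφ : IntegrableOn φ Ω) (hφ1 : ∀ᵐ x ∂(volume.restrict Ω), φ x = 1 ∨ φ x = -1)
    {ε : ℕ → ℝ} (hεpos : ∀ k, 0 < ε k) (hε : Tendsto ε atTop (𝓝 0))
    {ψ : ℕ → Euc d → ℝ} (hψ : ∀ k, IntegrableOn (ψ k) Ω)
    (hle : ∀ k, ∀ᵐ x ∂(volume.restrict Ω), |ψ k x| ≤ 1)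
    (hae : ∀ᵐ x ∂(volume.restrict Ω), Tendsto (fun k => ψ k x) atTop (𝓝 (φ x)))
    (hrate : (fun k => ∫ x in posSet Ω φ ∩ {x | ψ k x < 0}, |ψ k x - φ x|) =O[atTop] ε)
    {lam : ℝ} (hlam : Tendsto (fun k => firstEigenvalue Ω (b (ε k)) (ψ k)) atTop (𝓝 lam))
    {w : ℕ → H1 Ω} (hw1 : ∀ k, ‖(w k).fn‖ = 1)
    (hw : ∀ k, ‖(w k).grad‖ ^ 2 + ∫ x in Ω, b (ε k) (ψ k x) * (w k).fn x ^ 2 =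
      firstEigenvalue Ω (b (ε k)) (ψ k))
    {u : H1 Ω} (hu : u ∈ H10 Ω) (hweak : ∀ v, Tendsto (fun k => ⟪w k, v⟫) atTop (𝓝 ⟪u, v⟫))
    (hstrong : Tendsto (fun k => (w k).fn) atTop (𝓝 u.fn)) :
    u ∈ V Ω φ ∧ IsLeast {lam | ∃ v : H1 Ω, IsLimitEigenfunction Ω φ lam v} lam ∧
      IsLimitEigenfunction Ω φ lam u ∧
      Tendsto (fun k => ∫ x in Ω, b (ε k) (ψ k x) * (w k).fn x ^ 2) atTop (𝓝 0) ∧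
      Tendsto (fun k => ‖w k - u‖) atTop (𝓝 0) := by
  have hI0 : ∀ k, 0 ≤ ∫ x in Ω, b (ε k) (ψ k x) * (w k).fn x ^ 2 := fun k => by
    refine integral_nonneg_of_ae ?_
    filter_upwards [hb.ae_nonneg (hεpos k) (hle k)] with x hx
    exact mul_nonneg hx (sq_nonneg _)
  obtain ⟨L, hL⟩ := hlam.bddAbove_range
  have hIL : ∀ k, ∫ x in Ω, b (ε k) (ψ k x) * (w k).fn x ^ 2 ≤ L := fun k => by
    have := hL ⟨k, rfl⟩
    have := hw k
    have := sq_nonneg ‖(w k).grad‖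
    linarith
  have huV := mem_V_of_tendsto hb hφ hφ1 hΩ.measurableSet hεpos hε hψ hle hae hu hstrong hIL
  have hu1 : ‖u.fn‖ = 1 :=
    tendsto_nhds_unique hstrong.norm (by simp_rw [hw1]; exact tendsto_const_nhds)
  have hmin : ∀ η ∈ V Ω φ, lam * ‖η.fn‖ ^ 2 ≤ ‖η.grad‖ ^ 2 := fun η hη =>
    mul_norm_sq_le_of_tendsto hΩ hbd hb hφ hεpos hε hψ hle hae hrate hlam hη
  have hsum : Tendsto (fun k => ‖w k - u‖ ^ 2 + ∫ x in Ω, b (ε k) (ψ k x) * (w k).fn x ^ 2) atTop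
      (𝓝 (lam - ‖u.grad‖ ^ 2)) := by
    have h1 := ((hlam.const_add 1).sub ((hweak u).const_mul 2)).add_const (‖u‖ ^ 2)
    rw [real_inner_self_eq_norm_sq] at h1
    have h2 : 1 + lam - 2 * ‖u‖ ^ 2 + ‖u‖ ^ 2 = lam - ‖u.grad‖ ^ 2 := by
      rw [H1.norm_sq, hu1]
      ring
    rw [h2] at h1
    refine h1.congr fun k => ?_
    rw [norm_sub_sq_real, H1.norm_sq (w k), hw1, ← hw k]
    ring
  -- Nonnegativity of the sum in `hsum` gives one inequality, the minimality of λ tested at u the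
  -- other.
  have hlamu : ‖u.grad‖ ^ 2 = lam := by
    have h1 := ge_of_tendsto' hsum fun k => add_nonneg (sq_nonneg _) (hI0 k)
    have h2 := hmin u huV
    rw [hu1] at h2
    linarith
  rw [hlamu, sub_self] at hsum
  obtain ⟨hleast, heig⟩ := isLeast_of_isMinimizer hΩ huV hu1 hlamu hmin
  refine ⟨huV, hleast, heig, squeeze_zero hI0 (fun k => le_add_of_nonneg_left (sq_nonneg _)) hsum,
    ?_⟩
  have h1 := (squeeze_zero (fun k => sq_nonneg ‖w k - u‖)
    (fun k => le_add_of_nonneg_right (hI0 k)) hsum).sqrt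
  simpa using h1

theorem exists_subseq_tendsto_ae_of_integral {ψ : ℕ → Euc d → ℝ} (hφ : IntegrableOn φ Ω)
    (hψ : ∀ k, IntegrableOn (ψ k) Ω)
    (hconv : Tendsto (fun k => ∫ x in Ω, |ψ k x - φ x|) atTop (𝓝 0)) :
    ∃ s : ℕ → ℕ, StrictMono s ∧
      ∀ᵐ x ∂(volume.restrict Ω), Tendsto (fun k => ψ (s k) x) atTop (𝓝 (φ x)) := by
  refine (tendstoInMeasure_of_tendsto_eLpNorm one_ne_zero (fun k => (hψ k).1) hφ.1
    ?_).exists_seq_tendsto_ae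
  have h1 := ENNReal.tendsto_ofReal hconv
  rw [ENNReal.ofReal_zero] at h1
  refine h1.congr fun k => ?_
  rw [eLpNorm_one_eq_lintegral_enorm]
  exact ofReal_integral_norm_eq_lintegral_enorm ((hψ k).sub hφ)

end Limit

end PhaseField

end

/-! ### Extraction of the subsequence. -/

theorem mainTheorem5 {d : ℕ} (hd : 1 ≤ d)
    {Ω S₀ S₁ : Set (PhaseField.Euc d)} (hΩ : PhaseField.IsDesign Ω S₀ S₁)
    {b : ℝ → ℝ → ℝ} {b₀ : ℝ → ℝ≥0∞} {bbar : ℝ → ℝ}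
    (hb : PhaseField.IsCoefficientFamily b b₀ bbar)
    {φ : PhaseField.Euc d → ℝ} (hφBV : PhaseField.MemBVSign Ω φ)
    (hφU : PhaseField.MemU Ω S₀ S₁ φ)
    (hball : ∃ (z : PhaseField.Euc d) (r : ℝ), 0 < r ∧ Metric.ball z r ⊆ Ω ∧
      ∀ᵐ x ∂(volume.restrict (Metric.ball z r)), φ x = 1)
    {ε : ℕ → ℝ} (hεpos : ∀ k, 0 < ε k) (hε : Tendsto ε atTop (𝓝 0))
    {φε : ℕ → PhaseField.Euc d → ℝ} (hφεL1 : ∀ k, IntegrableOn (φε k) Ω)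
    (hφεle : ∀ k, ∀ᵐ x ∂(volume.restrict Ω), |φε k x| ≤ 1)
    (hconv : Tendsto (fun k => ∫ x in Ω, |φε k x - φ x|) atTop (𝓝 0))
    (hrate : (fun k => ∫ x in PhaseField.posSet Ω φ ∩ {x | φε k x < 0}, |φε k x - φ x|)
      =O[atTop] ε)
    {w : ℕ → PhaseField.H1 Ω}
    (hw : ∀ k, PhaseField.IsEigenfunction Ω (b (ε k)) (φε k)
      (PhaseField.firstEigenvalue Ω (b (ε k)) (φε k)) (w k))
    (hwnorm : ∀ k, ∫ x in Ω, (w k).fn x ^ 2 = 1) :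
    ∃ (s : ℕ → ℕ) (u : PhaseField.H1 Ω), StrictMono s ∧
      IsLeast {lam | ∃ v : PhaseField.H1 Ω, PhaseField.IsLimitEigenfunction Ω φ lam v}
        (PhaseField.limitFirstEigenvalue Ω φ) ∧
      PhaseField.IsLimitEigenfunction Ω φ (PhaseField.limitFirstEigenvalue Ω φ) u ∧
      (∀ k, Integrable (fun x => b (ε k) (φε k x) * (w k).fn x ^ 2) (volume.restrict Ω)) ∧
      Tendsto (fun j => ∫ x in Ω, b (ε (s j)) (φε (s j) x) * (w (s j)).fn x ^ 2) atTop (𝓝 0) ∧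
      ∫⁻ x in Ω, b₀ (φ x) * ENNReal.ofReal (u.fn x ^ 2) = 0 ∧
      Tendsto (fun j => ‖w (s j) - u‖) atTop (𝓝 0) ∧
      Tendsto (fun j => PhaseField.firstEigenvalue Ω (b (ε (s j))) (φε (s j))) atTop
        (𝓝 (PhaseField.limitFirstEigenvalue Ω φ)) := by
  have hφ : IntegrableOn φ Ω := hφBV.1.1
  have hw1 : ∀ k, ‖(w k).fn‖ = 1 := fun k => by
    have h := PhaseField.L2.norm_sq_eq_integral (w k).fn
    rw [hwnorm k] at h
    exact (pow_eq_one_iff_of_nonneg (norm_nonneg _) two_ne_zero).1 h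
  have hrayleigh : ∀ k, ‖(w k).grad‖ ^ 2 + ∫ x in Ω, b (ε k) (φε k x) * (w k).fn x ^ 2 =
      PhaseField.firstEigenvalue Ω (b (ε k)) (φε k) := fun k => by
    have hm := hb.memLp (hεpos k) (hφεL1 k).1 (hφεle k)
    have h := ((PhaseField.isEigenfunction_iff hm).1 (hw k)).2.2 _ (hw k).1
    rwa [PhaseField.energy, real_inner_self_eq_norm_sq, real_inner_self_eq_norm_sq,
      PhaseField.inner_mulOp_self, hw1, one_pow, mul_one] at h
  have hI0 : ∀ k, 0 ≤ ∫ x in Ω, b (ε k) (φε k x) * (w k).fn x ^ 2 := fun k => by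
    refine integral_nonneg_of_ae ?_
    filter_upwards [hb.ae_nonneg (hεpos k) (hφεle k)] with x hx
    exact mul_nonneg hx (sq_nonneg _)
  obtain ⟨s₁, hs₁, hae⟩ :=
    PhaseField.exists_subseq_tendsto_ae_of_integral hφ hφεL1 hconv
  obtain ⟨L, hL⟩ := PhaseField.exists_firstEigenvalue_le hΩ.isOpen hΩ.isBounded hb hφ
    (fun k => hεpos (s₁ k)) (hε.comp hs₁.tendsto_atTop) (fun k => hφεL1 (s₁ k))
    (fun k => hφεle (s₁ k)) hae (hrate.comp_tendsto hs₁.tendsto_atTop) hball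
  -- The limit of the eigenvalues is only some number here; it is identified with the limit
  -- eigenvalue at the end, as the least element of the set whose infimum defines it.
  obtain ⟨lam, -, s₂, hs₂, hlam⟩ := (isCompact_Icc (a := (0 : ℝ)) (b := L)).tendsto_subseq
    (x := fun k => PhaseField.firstEigenvalue Ω (b (ε (s₁ k))) (φε (s₁ k)))
    fun k => ⟨by rw [← hrayleigh]; exact add_nonneg (sq_nonneg _) (hI0 _), hL k⟩
  have hbound : ∀ k, ‖w (s₁ (s₂ k))‖ ≤ Real.sqrt (1 + L) := fun k => by
    refine Real.le_sqrt_of_sq_le ?_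
    rw [PhaseField.H1.norm_sq, hw1]
    have h1 := hrayleigh (s₁ (s₂ k))
    have h2 := hI0 (s₁ (s₂ k))
    have h3 := hL (s₂ k)
    linarith
  obtain ⟨u, s₃, hs₃, hu, hweak, hstrong⟩ :=
    PhaseField.exists_subseq_tendsto hΩ.isOpen hΩ.isBounded (fun k => (hw (s₁ (s₂ k))).1) hbound
  have hs₂₃ := hs₂.comp hs₃
  have hs := hs₁.comp hs₂₃
  have hae' : ∀ᵐ x ∂(volume.restrict Ω),
      Tendsto (fun k => φε (s₁ (s₂ (s₃ k))) x) atTop (𝓝 (φ x)) := by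
    filter_upwards [hae] with x hx using hx.comp hs₂₃.tendsto_atTop
  obtain ⟨huV, hleast, heig, hI, hnorm⟩ := PhaseField.tendsto_of_weak_tendsto hΩ.isOpen
    hΩ.isBounded hb hφ hφBV.2 (fun k => hεpos (s₁ (s₂ (s₃ k)))) (hε.comp hs.tendsto_atTop)
    (fun k => hφεL1 (s₁ (s₂ (s₃ k)))) (fun k => hφεle (s₁ (s₂ (s₃ k)))) hae'
    (hrate.comp_tendsto hs.tendsto_atTop) (hlam.comp hs₃.tendsto_atTop)
    (fun k => hw1 (s₁ (s₂ (s₃ k)))) (fun k => hrayleigh (s₁ (s₂ (s₃ k)))) hu hweak hstrong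
  have heq : PhaseField.limitFirstEigenvalue Ω φ = lam := hleast.csInf_eq
  rw [heq]
  refine ⟨_, u, hs, hleast, heig, fun k => PhaseField.integrable_coeff_mul_sq
    (hb.memLp (hεpos k) (hφεL1 k).1 (hφεle k)) _, hI, ?_, hnorm, hlam.comp hs₃.tendsto_atTop⟩
  rw [← lintegral_zero (μ := volume.restrict Ω)]
  refine lintegral_congr_ae ?_
  filter_upwards [huV.2] with x hx
  -- On E^φ the factor b₀(1) vanishes; elsewhere u does, and the product is 0 even where b₀(φ) = ∞.
  by_cases h : x ∈ PhaseField.posSet Ω φ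
  · rw [h.2, hb.zero_apply_one, zero_mul]
  · simp [hx h]
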